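/- Let $N\ge 1$ agents have objective functions $U_n:\mathbb{R}^d\to\mathbb{R}$, $n=1,\dots,N$, and put $U=\frac1N\sum_{n=1}^N U_n$. On a probability space let $\mathbf{x}_0$ be an arbitrary (deterministic or random) initial vector in $\mathbb{R}^{Nd}$, let $(L_t)_{t\ge0}$ be random Laplacian matrices of simple undirected graphs on $\{1,\dots,N\}$, and let $\boldsymbol{\zeta}_t=(\boldsymbol{\zeta}_n(t))_{n}$ and $\mathbf{w}_t=(\mathbf{w}_n(t))_{n}$, $t\ge 0$, be $\mathbb{R}^{Nd}$-valued random vectors with blocks in $\mathbb{R}^d$. Let $\mathcal{H}_t=\sigma(\mathbf{x}_0,L_0,\dots,L_{t-1},\boldsymbol{\zeta}_0,\dots,\boldsymbol{\zeta}_{t-1},\mathbf{w}_0,\dots,\mathbf{w}_{t-1})$. Let $(\alpha_t)$, $(\beta_t)$, $(\gamma_t)$ be real sequences, and suppose that the process $\mathbf{x}_t=(\mathbf{x}_n(t))_{n=1}^N$ satisfies, almost surely for all $t\ge0$, $$\mathbf{x}_{t+1}=\mathbf{x}_t-\beta_t(L_t\otimes I_d)\mathbf{x}_t-\alpha_t\big((\nabla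 U_n(\mathbf{x}_n(t)))_{n=1}^N+\boldsymbol{\zeta}_t\big)+\gamma_t\mathbf{w}_t .$$ All norms are Euclidean. Assume: 1. Each $U_n$ is $C^2$, and there is $K>0$ with $\|\nabla U_n(y)-\nabla U_n(y')\|\le K\|y-y'\|$ for all $n$ and all $y,y'\in\mathbb{R}^d$. 2. $\sup_{y\in\mathbb{R}^d}\|\nabla U_n(y)-\nabla U(y)\|<\infty$ for every $n$. 3. The matrices $(L_t)$ are i.i.d., $L_t$ is independent of $\mathcal{H}_t$ for every $t$, and $\lambda_2(\mathbb{E}[L_t])>0$, where $\lambda_2$ is the second smallest eigenvalue counted with multiplicity (this last condition is void if $N=1$). 4. There is $C_1>0$ such that $\mathbb{E}[\boldsymbol{\zeta}_t\mid\mathcal{H}_t]=0$ and $\mathbb{E}[\|\boldsymbol{\zeta}_t\|^2\mid\mathcal{H}_t]<C_1$ almost surely for all $t\ge0$. 5. For each $n$, $(\mathbf{w}_n(t))_{t\ge0}$ is an i.i.d. sequence of standard Gaussian vectors in $\mathbb{R}^d$ (covariance $I_d$) with $\mathbf{w}_n(t)$ independent of $\mathcal{H}_t$ for all $t$; and for $n\ne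 l$ the sequences $(\mathbf{w}_n(t))_{t}$ and $(\mathbf{w}_l(t))_{t}$ are independent of each other. 6. There are $c_\alpha,c_\beta,c_\gamma>0$ and $\tau_\beta\in(0,1/2)$ such that, for all sufficiently large $t$, $\alpha_t=c_\alpha/t$, $\beta_t=c_\beta/t^{\tau_\beta}$ and $\gamma_t=c_\gamma/\big(t^{1/2}\sqrt{\log\log t}\big)$. Let $\overline{\mathbf{x}}_t=\frac1N\sum_{l=1}^N\mathbf{x}_l(t)$. Then for every $\tau\in[0,\tfrac12-\tau_\beta)$ and every $n\in\{1,\dots,N\}$, $$\mathbb{P}\Big(\lim_{t\to\infty}(t+1)^{\tau}\,\|\mathbf{x}_n(t)-\overline{\mathbf{x}}_t\|=0\Big)=1 .$$ -/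

import Mathlib

open Filter Topology MeasureTheory ProbabilityTheory

namespace DistAnneal

noncomputable section

/-- The Borel σ-algebra on real matrices (product of the Borel σ-algebras of the entries). -/
instance instMeasurableSpaceMatrix {N : ℕ} : MeasurableSpace (Matrix (Fin N) (Fin N) ℝ) :=
  inferInstanceAs (MeasurableSpace (Fin N → Fin N → ℝ))

/-- `ℝ^{Nd}` with its Euclidean norm, seen as stacked vectors of `N` blocks in `ℝ^d`;
the block of agent `n` in `z` is `z n`. -/
abbrev Stack (N d : ℕ) : Type := PiLp 2 (fun _ : Fin N => EuclideanSpace ℝ (Fin d))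

/-- The Laplacian matrix `D - A` of a simple undirected graph on the agents. -/
def laplacian {N : ℕ} (G : SimpleGraph (Fin N)) : Matrix (Fin N) (Fin N) ℝ := by
  classical exact G.lapMatrix ℝ

/-- The vector `(M ⊗ I_d) z`: its `n`-th block is `∑ l, M n l • z l`. -/
def kronAct {N d : ℕ} (M : Matrix (Fin N) (Fin N) ℝ) (z : Stack N d) : Stack N d :=
  WithLp.toLp 2 (fun n => ∑ l, M n l • z l)

/-- For a graph Laplacian, the `n`-th block of `(L ⊗ I_d) z` is the sum of `z n - z l` over the
neighbors `l` of `n`. -/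
theorem kronAct_laplacian {N d : ℕ} (G : SimpleGraph (Fin N)) [DecidableRel G.Adj]
    (z : Stack N d) (n : Fin N) :
    kronAct (laplacian G) z n = ∑ l ∈ G.neighborFinset n, (z n - z l) := by
  have h : laplacian G = G.lapMatrix ℝ := by
    unfold laplacian
    congr
  have e : ∀ l, (G.lapMatrix ℝ) n l • z l
      = (if n = l then (G.degree n : ℝ) • z l else 0) - (if G.Adj n l then z l else 0) := by
    intro l
    simp only [SimpleGraph.lapMatrix, SimpleGraph.degMatrix, Matrix.sub_apply,
      Matrix.diagonal_apply, SimpleGraph.adjMatrix_apply, sub_smul]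
    split_ifs <;> simp
  have h2 : kronAct (laplacian G) z n = ∑ l, (G.lapMatrix ℝ) n l • z l := by
    rw [h]; rfl
  rw [h2, Finset.sum_congr rfl (fun l _ => e l), Finset.sum_sub_distrib, Finset.sum_sub_distrib,
    Finset.sum_const, SimpleGraph.card_neighborFinset_eq_degree, ← Finset.sum_filter (G.Adj n)]
  simp [SimpleGraph.neighborFinset_eq_filter, Nat.cast_smul_eq_nsmul]

/-- The objective function `U = (1/N) ∑ U_n`. -/
def avgObjective {N d : ℕ} (U : Fin N → EuclideanSpace ℝ (Fin d) → ℝ) :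
    EuclideanSpace ℝ (Fin d) → ℝ :=
  fun y => (1 / (N : ℝ)) * ∑ n, U n y

/-- The stacked vector of the local gradients `∇U_n (z n)`. -/
def stackGrad {N d : ℕ} (U : Fin N → EuclideanSpace ℝ (Fin d) → ℝ) (z : Stack N d) : Stack N d :=
  WithLp.toLp 2 (fun n => gradient (U n) (z n))

/-- The network average `(1/N) ∑ z_l`. -/
def netAvg {N d : ℕ} (z : Stack N d) : EuclideanSpace ℝ (Fin d) :=
  (1 / (N : ℝ)) • ∑ l, z l

/-- `λ₂(M)`, the second smallest eigenvalue (with multiplicity) of a symmetric `N × N` matrix with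
`N ≥ 2`. Mathlib's `eigenvalues₀` lists the eigenvalues in decreasing order. -/
def lambdaTwo {N : ℕ} {M : Matrix (Fin N) (Fin N) ℝ} (hM : M.IsHermitian) (hN : 2 ≤ N) : ℝ :=
  hM.eigenvalues₀ ⟨N - 2, by rw [Fintype.card_fin]; omega⟩

section Randomness

variable {N d : ℕ} {Ω : Type*} [MeasurableSpace Ω]

/-- The mean Laplacian `E[L_t]`, entry by entry. -/
def meanLaplacian (P : Measure Ω) (G : ℕ → Ω → SimpleGraph (Fin N)) (t : ℕ) :
    Matrix (Fin N) (Fin N) ℝ :=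
  Matrix.of fun i j => ∫ ω, laplacian (G t ω) i j ∂P

theorem meanLaplacian_isHermitian (P : Measure Ω) (G : ℕ → Ω → SimpleGraph (Fin N)) (t : ℕ) :
    (meanLaplacian P G t).IsHermitian := by
  classical
  ext i j
  simp only [Matrix.conjTranspose_apply, meanLaplacian, Matrix.of_apply, star_trivial]
  congr 1
  funext ω
  exact ((G t ω).isSymm_lapMatrix (R := ℝ)).apply i j

/-- The natural filtration
`H_t = σ(x_0, L_0, …, L_{t-1}, ζ_0, …, ζ_{t-1}, w_0, …, w_{t-1})`. By construction
`L_t`, `ζ_t` and `w_t` are `H_{t+1}`-measurable. -/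
@[reducible] def natFiltration (x₀ : Ω → Stack N d) (G : ℕ → Ω → SimpleGraph (Fin N))
    (ζ w : ℕ → Ω → Stack N d) (t : ℕ) : MeasurableSpace Ω :=
  MeasurableSpace.comap x₀ inferInstance ⊔
    ⨆ s : Fin t,
      (MeasurableSpace.comap (fun ω => laplacian (G s ω)) inferInstance ⊔
        MeasurableSpace.comap (ζ s) inferInstance ⊔
        MeasurableSpace.comap (w s) inferInstance)

/-- The local objectives are `C²` with Lipschitz gradients (with a common constant). -/
structure LipschitzGradients (U : Fin N → EuclideanSpace ℝ (Fin d) → ℝ) : Prop where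
  contDiff : ∀ n, ContDiff ℝ 2 (U n)
  lipschitz : ∃ K : ℝ, 0 < K ∧ ∀ n, ∀ y y' : EuclideanSpace ℝ (Fin d),
    ‖gradient (U n) y - gradient (U n) y'‖ ≤ K * ‖y - y'‖

/-- Bounded gradient-dissimilarity. -/
def BoundedDissimilarity (U : Fin N → EuclideanSpace ℝ (Fin d) → ℝ) : Prop :=
  ∀ n, BddAbove (Set.range fun y => ‖gradient (U n) y - gradient (avgObjective U) y‖)

/-- The Laplacians are i.i.d. random matrices, `L_t` is independent of `H_t`, and the network is
connected in the mean. For a single agent there is no second eigenvalue and the last condition is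
empty. -/
structure MeanConnectedLaplacians (P : Measure Ω) (x₀ : Ω → Stack N d)
    (G : ℕ → Ω → SimpleGraph (Fin N)) (ζ w : ℕ → Ω → Stack N d) : Prop where
  measurable : ∀ t, Measurable fun ω => laplacian (G t ω)
  indep : iIndepFun (fun t ω => laplacian (G t ω)) P
  identDistrib : ∀ t,
    IdentDistrib (fun ω => laplacian (G t ω)) (fun ω => laplacian (G 0 ω)) P P
  indep_past : ∀ t,
    Indep (MeasurableSpace.comap (fun ω => laplacian (G t ω)) inferInstance)
      (natFiltration x₀ G ζ w t) P
  connected : ∀ hN : 2 ≤ N, 0 < lambdaTwo (meanLaplacian_isHermitian P G 0) hN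

/-- The gradient noise has zero conditional mean and uniformly bounded conditional second moment.
Square integrability is what makes both conditional expectations meaningful; it is implied by
the bound on the conditional second moment when that is read in the extended sense. -/
structure GradientNoise (P : Measure Ω) (x₀ : Ω → Stack N d)
    (G : ℕ → Ω → SimpleGraph (Fin N)) (ζ w : ℕ → Ω → Stack N d) : Prop where
  measurable : ∀ t, Measurable (ζ t)
  memLp : ∀ t, MemLp (ζ t) 2 P
  condMean : ∀ t, P[ζ t | natFiltration x₀ G ζ w t] =ᵐ[P] 0
  condSecondMoment : ∃ C₁ : ℝ, 0 < C₁ ∧ ∀ t,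
    ∀ᵐ ω ∂P, (P[fun ω' => ‖ζ t ω'‖ ^ 2 | natFiltration x₀ G ζ w t]) ω < C₁

/-- The annealing noise: for each agent an i.i.d. sequence of standard Gaussian vectors,
independent of the past; the sequences of distinct agents are independent of each other. -/
structure GaussianNoise (P : Measure Ω) (x₀ : Ω → Stack N d)
    (G : ℕ → Ω → SimpleGraph (Fin N)) (ζ w : ℕ → Ω → Stack N d) : Prop where
  measurable : ∀ t, Measurable (w t)
  gaussian : ∀ n t, P.map (fun ω => w t ω n) = stdGaussian (EuclideanSpace ℝ (Fin d))
  indep : ∀ n, iIndepFun (fun t ω => w t ω n) P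
  indep_past : ∀ n t,
    Indep (MeasurableSpace.comap (fun ω => w t ω n) inferInstance)
      (natFiltration x₀ G ζ w t) P
  indep_agents : ∀ n l, n ≠ l → IndepFun (fun ω t => w t ω n) (fun ω t => w t ω l) P

/-- The weight sequences; the formulas are required for all large `t` only. -/
structure Weights (α β γ : ℕ → ℝ) (cα cβ cγ τβ : ℝ) : Prop where
  cα_pos : 0 < cα
  cβ_pos : 0 < cβ
  cγ_pos : 0 < cγ
  τβ_mem : τβ ∈ Set.Ioo (0 : ℝ) (1 / 2)
  α_eq : ∀ᶠ t : ℕ in atTop, α t = cα / (t : ℝ)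
  β_eq : ∀ᶠ t : ℕ in atTop, β t = cβ / (t : ℝ) ^ τβ
  γ_eq : ∀ᶠ t : ℕ in atTop,
    γ t = cγ / ((t : ℝ) ^ (1 / 2 : ℝ) * Real.sqrt (Real.log (Real.log (t : ℝ))))

/-- The algorithm in vector form,
`x_{t+1} = x_t - β_t (L_t ⊗ I_d) x_t - α_t (∇U(x_t) + ζ_t) + γ_t w_t` almost surely, started from
a (possibly constant) random vector `x_0`. -/
structure IsUpdateProcess (P : Measure Ω) (U : Fin N → EuclideanSpace ℝ (Fin d) → ℝ)
    (α β γ : ℕ → ℝ) (G : ℕ → Ω → SimpleGraph (Fin N)) (ζ w x : ℕ → Ω → Stack N d) : Prop where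
  measurable_init : Measurable (x 0)
  step : ∀ t, ∀ᵐ ω ∂P,
    x (t + 1) ω = x t ω - β t • kronAct (laplacian (G t ω)) (x t ω)
      - α t • (stackGrad U (x t ω) + ζ t ω) + γ t • w t ω

end Randomness

end

end DistAnneal

/-! Subtracting the network average from every block (`disagreement`) commutes with graph Laplacians
and kills consensus vectors. The disagreement of the process therefore obeys a linear consensus
recursion with contraction `I - β_t L_t`, perturbed by gradients, gradient noise and Gaussian noise.

Contraction in the mean. A single `L_t` may be disconnected, so pathwise the step is only
non-expansive, with gain `b ⟪z, L z⟫` in the squared norm. Since `L_t` is independent of the past,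
taking expectations replaces `L_t` by its mean, which is coercive on zero-sum vectors because its
second eigenvalue is positive. This gives a factor `1 - c β_t` for every moment of order at least 2.
A perturbation is added by convexity, with no independence from the state needed: if its `q`-th
moment is of order `t ^ (-ρ q)`, that of the state is of order `t ^ (-q (ρ - τβ))`
(`exists_integral_norm_pow_le_rpow`).

Splitting. Summing moments to get almost sure decay needs `q (ρ - τβ - τ) > 1`. The Gaussian term
has `ρ = 1/2`, so `q` must be large, but all its moments are finite. The gradient terms have only
second moments, but there `ρ = 1` and `q = 2` suffices. The disagreement is thus split into a
process `u` driven by the Gaussian noise alone and a remainder `v`. No moment of the initial vector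
is assumed, so `v` is divided by a random variable known at the starting time `t₀`, which makes `v`
bounded there. -/

namespace DistAnneal

noncomputable section

/-! ### Disagreement and the Laplacian quadratic form -/

variable {N d : ℕ} {Ω : Type*}

/-- The disagreement `z ↦ (z n - netAvg z)ₙ`. -/
def disagreement : Stack N d →ₗ[ℝ] Stack N d where
  toFun z := WithLp.toLp 2 (fun n => z n - netAvg z)
  map_add' z z' := by
    ext n k
    simp [netAvg, Finset.sum_add_distrib]
    ring
  map_smul' c z := by
    ext n k
    simp [netAvg, ← Finset.mul_sum]
    ring

theorem disagreement_apply (z : Stack N d) (n : Fin N) :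
    disagreement z n = z n - netAvg z := rfl

theorem sum_disagreement (z : Stack N d) : ∑ n, disagreement z n = 0 := by
  rcases Nat.eq_zero_or_pos N with rfl | hN
  · simp
  · have : (N : ℝ) ≠ 0 := by positivity
    simp only [disagreement_apply, Finset.sum_sub_distrib, Finset.sum_const, Finset.card_univ,
      Fintype.card_fin, netAvg, ← Nat.cast_smul_eq_nsmul ℝ, smul_smul]
    rw [mul_one_div_cancel this, one_smul, sub_self]

theorem disagreement_const (y : EuclideanSpace ℝ (Fin d)) :
    disagreement (WithLp.toLp 2 (fun _ : Fin N => y)) = 0 := by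
  ext n k
  have : (N : ℝ) ≠ 0 := by
    have := n.pos
    positivity
  simp [disagreement_apply, netAvg, this]

theorem kronAct_apply (M : Matrix (Fin N) (Fin N) ℝ) (z : Stack N d) (n : Fin N) :
    kronAct M z n = ∑ l, M n l • z l := rfl

theorem kronAct_sub (M : Matrix (Fin N) (Fin N) ℝ) (z z' : Stack N d) :
    kronAct M (z - z') = kronAct M z - kronAct M z' := by
  ext n k
  simp [kronAct_apply, mul_sub, Finset.sum_sub_distrib]

theorem kronAct_smul (M : Matrix (Fin N) (Fin N) ℝ) (c : ℝ) (z : Stack N d) :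
    kronAct M (c • z) = c • kronAct M z := by
  ext n k
  simp only [kronAct_apply, PiLp.smul_apply, Finset.smul_sum, smul_comm c]

theorem inner_kronAct (M : Matrix (Fin N) (Fin N) ℝ) (z : Stack N d) :
    inner ℝ z (kronAct M z) = ∑ n, ∑ l, M n l * inner ℝ (z n) (z l) := by
  simp only [PiLp.inner_apply, kronAct_apply, inner_sum, inner_smul_right]

theorem laplacian_isSymm (G : SimpleGraph (Fin N)) (i j : Fin N) :
    laplacian G i j = laplacian G j i := by
  classical
  exact (G.isSymm_lapMatrix (R := ℝ)).apply j i

theorem sum_laplacian_row (G : SimpleGraph (Fin N)) (n : Fin N) : ∑ l, laplacian G n l = 0 := by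
  classical
  have h : G.lapMatrix ℝ n = laplacian G n := by
    unfold laplacian
    congr!
  have := congrFun (G.lapMatrix_mulVec_const_eq_zero (R := ℝ)) n
  simpa [Matrix.mulVec, dotProduct, h] using this

theorem abs_laplacian_le (G : SimpleGraph (Fin N)) (i j : Fin N) : |laplacian G i j| ≤ N := by
  classical
  have h : laplacian G i j = G.lapMatrix ℝ i j := by
    unfold laplacian
    congr!
  have hN : (1 : ℝ) ≤ N := by exact_mod_cast i.pos
  rw [h]
  by_cases hij : i = j
  · subst hij
    have h1 : (G.degree i : ℝ) ≤ N := by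
      have := (G.degree_lt_card_verts i).le
      rw [Fintype.card_fin] at this
      exact_mod_cast this
    simpa [SimpleGraph.lapMatrix, SimpleGraph.degMatrix] using h1
  · simp only [SimpleGraph.lapMatrix, SimpleGraph.degMatrix, Matrix.sub_apply,
      Matrix.diagonal_apply_ne _ hij, SimpleGraph.adjMatrix_apply]
    split_ifs
    · simpa using hN
    · simp

theorem disagreement_kronAct_laplacian (G : SimpleGraph (Fin N)) (z : Stack N d) :
    disagreement (kronAct (laplacian G) z) = kronAct (laplacian G) (disagreement z) := by
  have h1 : ∑ n, kronAct (laplacian G) z n = 0 := by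
    simp only [kronAct_apply]
    rw [Finset.sum_comm]
    refine Finset.sum_eq_zero fun l _ => ?_
    rw [← Finset.sum_smul]
    simp_rw [laplacian_isSymm G _ l, sum_laplacian_row, zero_smul]
  ext n : 1
  change disagreement (kronAct (laplacian G) z) n = kronAct (laplacian G) (disagreement z) n
  rw [disagreement_apply, netAvg, h1, smul_zero, sub_zero, kronAct_apply, kronAct_apply]
  simp only [disagreement_apply, smul_sub, Finset.sum_sub_distrib, ← Finset.sum_smul,
    sum_laplacian_row, zero_smul, sub_zero]

/-- Adjacency is symmetric, so exchanging the two summation indices gives a second expression for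
the same form; averaging the two produces the squared differences. -/
theorem inner_kronAct_laplacian (G : SimpleGraph (Fin N)) [DecidableRel G.Adj] (z : Stack N d) :
    inner ℝ z (kronAct (laplacian G) z)
      = (1 / 2) * ∑ n, ∑ l, if G.Adj n l then ‖z n - z l‖ ^ 2 else 0 := by
  have e1 : inner ℝ z (kronAct (laplacian G) z)
      = ∑ n, ∑ l, if G.Adj n l then inner ℝ (z n) (z n - z l) else 0 := by
    rw [PiLp.inner_apply]
    refine Finset.sum_congr rfl fun n _ => ?_
    rw [kronAct_laplacian, inner_sum, SimpleGraph.neighborFinset_eq_filter, Finset.sum_filter]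
  have e2 : inner ℝ z (kronAct (laplacian G) z)
      = ∑ n, ∑ l, if G.Adj n l then - inner ℝ (z l) (z n - z l) else 0 := by
    rw [e1, Finset.sum_comm]
    refine Finset.sum_congr rfl fun n _ => Finset.sum_congr rfl fun l _ => ?_
    simp only [G.adj_comm l n, ← inner_neg_right, neg_sub]
  have e3 : inner ℝ z (kronAct (laplacian G) z) + inner ℝ z (kronAct (laplacian G) z)
      = ∑ n, ∑ l, if G.Adj n l then ‖z n - z l‖ ^ 2 else 0 := by
    conv_lhs => rw [e2]
    conv_lhs =>
      arg 2
      rw [← e2, e1]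
    rw [← Finset.sum_add_distrib]
    refine Finset.sum_congr rfl fun n _ => ?_
    rw [← Finset.sum_add_distrib]
    refine Finset.sum_congr rfl fun l _ => ?_
    split_ifs
    · rw [← real_inner_self_eq_norm_sq, inner_sub_left]
      ring
    · simp
  linarith

theorem inner_kronAct_laplacian_nonneg (G : SimpleGraph (Fin N)) (z : Stack N d) :
    0 ≤ inner ℝ z (kronAct (laplacian G) z) := by
  classical
  rw [inner_kronAct_laplacian]
  refine mul_nonneg (by norm_num) (Finset.sum_nonneg fun n _ => Finset.sum_nonneg fun l _ => ?_)
  split_ifs <;> positivity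

/-- Each block is a sum of at most `N` differences, so Cauchy–Schwarz costs a factor `N`; the factor
2 appears because the form carries `1/2` over ordered pairs. -/
theorem norm_kronAct_laplacian_sq_le (G : SimpleGraph (Fin N)) (z : Stack N d) :
    ‖kronAct (laplacian G) z‖ ^ 2 ≤ 2 * N * inner ℝ z (kronAct (laplacian G) z) := by
  classical
  have e : 2 * N * inner ℝ z (kronAct (laplacian G) z)
      = ∑ n, N * ∑ l, if G.Adj n l then ‖z n - z l‖ ^ 2 else 0 := by
    rw [inner_kronAct_laplacian, ← Finset.mul_sum]
    ring
  rw [e, PiLp.norm_sq_eq_of_L2]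
  refine Finset.sum_le_sum fun n _ => ?_
  rw [kronAct_laplacian, ← Finset.sum_filter, ← SimpleGraph.neighborFinset_eq_filter]
  have h1 := norm_sum_le (G.neighborFinset n) (fun l => z n - z l)
  have h2 := sq_sum_le_card_mul_sum_sq (s := G.neighborFinset n) (f := fun l => ‖z n - z l‖)
  have h3 : ((G.neighborFinset n).card : ℝ) ≤ N := by
    have := Finset.card_le_univ (G.neighborFinset n)
    rw [Fintype.card_fin] at this
    exact_mod_cast this
  have h4 : 0 ≤ ∑ l ∈ G.neighborFinset n, ‖z n - z l‖ ^ 2 :=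
    Finset.sum_nonneg fun _ _ => by positivity
  calc _ ≤ (∑ l ∈ G.neighborFinset n, ‖z n - z l‖) ^ 2 := by gcongr
    _ ≤ _ := h2
    _ ≤ _ := by gcongr

/-- The cross term yields `-2 b ⟪z, L z⟫`; for small `b` the quadratic term gives back at most half
of it. -/
theorem norm_sub_smul_kronAct_sq_le (G : SimpleGraph (Fin N)) (z : Stack N d) {b : ℝ}
    (hb : 0 ≤ b) (hbN : 2 * N * b ≤ 1) :
    ‖z - b • kronAct (laplacian G) z‖ ^ 2
      ≤ ‖z‖ ^ 2 - b * inner ℝ z (kronAct (laplacian G) z) := by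
  have h1 := norm_kronAct_laplacian_sq_le G z
  have h2 := inner_kronAct_laplacian_nonneg G z
  rw [norm_sub_sq_real, inner_smul_right, norm_smul, mul_pow, Real.norm_eq_abs, sq_abs]
  have h3 : b * (b * ‖kronAct (laplacian G) z‖ ^ 2)
      ≤ b * (b * (2 * N * inner ℝ z (kronAct (laplacian G) z))) := by gcongr
  have h4 : b * ((2 * N * b) * inner ℝ z (kronAct (laplacian G) z))
      ≤ b * (1 * inner ℝ z (kronAct (laplacian G) z)) := by gcongr
  nlinarith

/-! ### Coercivity from the second eigenvalue -/

/-- A symmetric matrix that kills constants and whose second smallest eigenvalue is positive is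
coercive on vectors with zero sum. -/
theorem lambdaTwo_mul_norm_sq_le {M : Matrix (Fin N) (Fin N) ℝ} (hM : M.IsHermitian)
    (hN : 2 ≤ N) (hpos : 0 < lambdaTwo hM hN) (hM1 : ∀ n, ∑ l, M n l = 0)
    (v : EuclideanSpace ℝ (Fin N)) (hv : ∑ n, v n = 0) :
    lambdaTwo hM hN * ‖v‖ ^ 2 ≤ ∑ n, ∑ l, M n l * (v n * v l) := by
  set b := hM.eigenvectorBasis with hb
  set T := Matrix.toEuclideanLin M with hT
  have hTs : T.IsSymmetric := Matrix.isSymmetric_toEuclideanLin_iff.2 hM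
  have hTb : ∀ i, T (b i) = hM.eigenvalues i • b i := by
    intro i
    have := hM.mulVec_eigenvectorBasis i
    ext k
    simpa [hT, Matrix.toLpLin_apply] using congrFun this k
  set one : EuclideanSpace ℝ (Fin N) := WithLp.toLp 2 (fun _ => 1) with hone
  have hTone : T one = 0 := by
    ext k
    simp [hT, hone, Matrix.toLpLin_apply, Matrix.mulVec, dotProduct, hM1]
  have hvone : inner ℝ v one = 0 := by
    simp [hone, PiLp.inner_apply, hv]
  have hcoef : ∀ i, hM.eigenvalues i * inner ℝ (b i) one = 0 := by
    intro i
    have := hTs (b i) one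
    rw [hTone, inner_zero_right, hTb, inner_smul_left] at this
    simpa using this
  -- all indices but one have eigenvalue at least `lambdaTwo`
  have hcard : Fintype.card (Fin N) = N := Fintype.card_fin N
  obtain ⟨j, hj⟩ : ∃ j, ∀ i, i ≠ j → lambdaTwo hM hN ≤ hM.eigenvalues i := by
    set e := Fintype.equivOfCardEq (Fintype.card_fin (Fintype.card (Fin N))) with he
    refine ⟨e ⟨N - 1, by rw [hcard]; omega⟩, fun i hi => ?_⟩
    have h1 : hM.eigenvalues i = hM.eigenvalues₀ (e.symm i) := rfl
    rw [h1]
    refine hM.eigenvalues₀_antitone ?_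
    have h2 : e.symm i ≠ ⟨N - 1, by rw [hcard]; omega⟩ := by
      intro h
      exact hi (by rw [← h, Equiv.apply_symm_apply])
    have h3 := (e.symm i).isLt
    have h4 : (e.symm i : ℕ) ≠ N - 1 := fun h => h2 (Fin.ext h)
    have h5 := h3.trans_eq hcard
    change (e.symm i : ℕ) ≤ N - 2
    omega
  -- The constant vector lies in the kernel, so it is orthogonal to every eigenvector with positive
  -- eigenvalue, that is, to all but `b j`. It is thus a nonzero multiple of `b j`, and a zero-sum
  -- `v` is orthogonal to `b j`.
  have honeb : one = (inner ℝ (b j) one : ℝ) • b j := by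
    conv_lhs => rw [← b.sum_repr' one]
    refine Finset.sum_eq_single j (fun i _ hi => ?_) (by simp)
    have := hcoef i
    rcases mul_eq_zero.1 this with h | h
    · have := hj i hi
      linarith
    · rw [h, zero_smul]
  have hvj : inner ℝ (b j) v = 0 := by
    have h1 : inner ℝ v one = inner ℝ (b j) one * inner ℝ v (b j) := by
      conv_lhs => rw [honeb]
      rw [inner_smul_right]
    rw [hvone] at h1
    rcases mul_eq_zero.1 h1.symm with h | h
    · exfalso
      rw [h, zero_smul] at honeb
      have := congrArg (fun z : EuclideanSpace ℝ (Fin N) => z ⟨0, by omega⟩) honeb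
      simp [hone] at this
    · rw [real_inner_comm]
      exact h
  have e1 : ∑ n, ∑ l, M n l * (v n * v l) = inner ℝ v (T v) := by
    simp only [hT, PiLp.inner_apply, Matrix.toLpLin_apply, Matrix.mulVec, dotProduct]
    refine Finset.sum_congr rfl fun n _ => ?_
    simp only [RCLike.inner_apply, conj_trivial, Finset.sum_mul]
    exact Finset.sum_congr rfl fun l _ => by ring
  have e2 : inner ℝ v (T v) = ∑ i, hM.eigenvalues i * inner ℝ (b i) v ^ 2 := by
    rw [← b.sum_inner_mul_inner]
    refine Finset.sum_congr rfl fun i _ => ?_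
    rw [← hTs, hTb, inner_smul_left, real_inner_comm]
    simp only [conj_trivial]
    ring
  have e3 : ‖v‖ ^ 2 = ∑ i, inner ℝ (b i) v ^ 2 := by
    rw [← b.sum_sq_norm_inner_right]
    simp
  rw [e1, e2, e3, Finset.mul_sum]
  refine Finset.sum_le_sum fun i _ => ?_
  by_cases hi : i = j
  · rw [hi, hvj]
    simp
  · exact mul_le_mul_of_nonneg_right (hj i hi) (sq_nonneg _)

/-- The form splits over the `d` coordinates, each of which is a zero-sum vector in `ℝ^N`. The bound
`c ≤ 1` later keeps the convexity weight below 1. -/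
theorem exists_coercive_kronAct {M : Matrix (Fin N) (Fin N) ℝ} (hM : M.IsHermitian)
    (hpos : ∀ hN : 2 ≤ N, 0 < lambdaTwo hM hN) (hM1 : ∀ n, ∑ l, M n l = 0) :
    ∃ c : ℝ, 0 < c ∧ c ≤ 1 ∧ ∀ z : Stack N d, ∑ n, z n = 0 →
      c * ‖z‖ ^ 2 ≤ inner ℝ z (kronAct M z) := by
  by_cases hN : 2 ≤ N
  · refine ⟨min (lambdaTwo hM hN) 1, lt_min (hpos hN) one_pos, min_le_right _ _, fun z hz => ?_⟩
    have h1 : ∀ k : Fin d, lambdaTwo hM hN * ∑ n, (z n k) ^ 2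
        ≤ ∑ n, ∑ l, M n l * (z n k * z l k) := by
      intro k
      have := lambdaTwo_mul_norm_sq_le hM hN (hpos hN) hM1 (WithLp.toLp 2 fun n => z n k) (by
        have := congrArg (fun y : EuclideanSpace ℝ (Fin d) => y k) hz
        simpa using this)
      simpa [EuclideanSpace.norm_sq_eq] using this
    have e1 : ‖z‖ ^ 2 = ∑ k, ∑ n, (z n k) ^ 2 := by
      rw [PiLp.norm_sq_eq_of_L2, Finset.sum_comm]
      simp [EuclideanSpace.norm_sq_eq]
    have e2 : inner ℝ z (kronAct M z) = ∑ k, ∑ n, ∑ l, M n l * (z n k * z l k) := by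
      rw [inner_kronAct, Finset.sum_comm]
      rw [Finset.sum_comm (s := (Finset.univ : Finset (Fin d)))]
      rw [Finset.sum_comm]
      refine Finset.sum_congr rfl fun n _ => ?_
      rw [Finset.sum_comm]
      refine Finset.sum_congr rfl fun l _ => ?_
      rw [← Finset.mul_sum]
      simp [PiLp.inner_apply, mul_comm]
    have h2 := Finset.sum_le_sum fun k (_ : k ∈ Finset.univ) => h1 k
    rw [← Finset.mul_sum, ← e1, ← e2] at h2
    exact (mul_le_mul_of_nonneg_right (min_le_left _ _) (sq_nonneg _)).trans h2
  -- With at most one agent, a zero-sum stack vanishes.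
  · refine ⟨1, one_pos, le_rfl, fun z hz => ?_⟩
    have hz0 : z = 0 := by
      ext n : 1
      have : ∀ l : Fin N, l = n := fun l => by
        ext
        have := l.isLt
        have := n.isLt
        omega
      rw [Finset.sum_eq_single n (fun l _ h => absurd (this l) h) (by simp)] at hz
      exact hz
    subst hz0
    simp

/-! ### One-step contraction of moments -/

theorem measurable_entry {A : Ω → Matrix (Fin N) (Fin N) ℝ} {m : MeasurableSpace Ω}
    (hA : Measurable[m] A) (i j : Fin N) : Measurable[m] fun ω => A ω i j :=
  (measurable_pi_apply j).comp ((measurable_pi_apply i).comp hA)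

theorem measurable_kronAct {m : MeasurableSpace Ω} {A : Ω → Matrix (Fin N) (Fin N) ℝ}
    (hA : Measurable[m] A) {z : Ω → Stack N d} (hz : Measurable[m] z) :
    Measurable[m] fun ω => kronAct (A ω) (z ω) := by
  refine (WithLp.measurable_toLp 2 _).comp (measurable_pi_lambda _ fun n => ?_)
  refine Finset.measurable_sum _ fun l _ => (measurable_entry hA n l).smul ?_
  exact (measurable_pi_apply l).comp ((WithLp.measurable_ofLp 2 _).comp hz)

/-- The step is non-expansive, so `p` of the factors are bounded by `‖z‖` and the gain comes from
the remaining square. -/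
theorem norm_pow_sub_smul_kronAct_le (G : SimpleGraph (Fin N)) (z : Stack N d) {b : ℝ}
    (hb : 0 ≤ b) (hbN : 2 * N * b ≤ 1) (p : ℕ) :
    ‖z - b • kronAct (laplacian G) z‖ ^ (p + 2)
      ≤ ‖z‖ ^ (p + 2) - b * (‖z‖ ^ p * inner ℝ z (kronAct (laplacian G) z)) := by
  have h1 := norm_sub_smul_kronAct_sq_le G z hb hbN
  have h2 := mul_nonneg hb (inner_kronAct_laplacian_nonneg G z)
  have h3 : ‖z - b • kronAct (laplacian G) z‖ ≤ ‖z‖ :=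
    le_of_sq_le_sq (by linarith) (norm_nonneg _)
  calc _ = ‖z - b • kronAct (laplacian G) z‖ ^ p * ‖z - b • kronAct (laplacian G) z‖ ^ 2 :=
        pow_add _ _ _
    _ ≤ ‖z‖ ^ p * (‖z‖ ^ 2 - b * inner ℝ z (kronAct (laplacian G) z)) := by gcongr
    _ = _ := by ring

/-- Contraction in the mean of a step of the consensus dynamics. -/
theorem integral_norm_pow_sub_smul_kronAct_le {m mΩ : MeasurableSpace Ω} {P : Measure Ω} [IsProbabilityMeasure P]
    (hm : m ≤ mΩ) {G : Ω → SimpleGraph (Fin N)}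
    (hG : Measurable fun ω => laplacian (G ω))
    (hind : Indep (MeasurableSpace.comap (fun ω => laplacian (G ω)) inferInstance) m P)
    {c : ℝ} (hcoer : ∀ z : Stack N d, ∑ n, z n = 0 → c * ‖z‖ ^ 2
      ≤ inner ℝ z (kronAct (Matrix.of fun i j => ∫ ω, laplacian (G ω) i j ∂P) z))
    {z : Ω → Stack N d} (hz : Measurable[m] z) (hz0 : ∀ ω, ∑ n, z ω n = 0) {p : ℕ}
    (hzi : Integrable (fun ω => ‖z ω‖ ^ (p + 2)) P) {b : ℝ} (hb : 0 ≤ b) (hbN : 2 * N * b ≤ 1) :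
    Integrable (fun ω => ‖z ω - b • kronAct (laplacian (G ω)) (z ω)‖ ^ (p + 2)) P ∧
    ∫ ω, ‖z ω - b • kronAct (laplacian (G ω)) (z ω)‖ ^ (p + 2) ∂P
      ≤ (1 - c * b) * ∫ ω, ‖z ω‖ ^ (p + 2) ∂P := by
  have hz' : Measurable z := hz.mono hm le_rfl
  have hLz := measurable_kronAct hG hz'
  have hInt : Integrable (fun ω => ‖z ω - b • kronAct (laplacian (G ω)) (z ω)‖ ^ (p + 2)) P := by
    refine hzi.mono' (by fun_prop) (ae_of_all _ fun ω => ?_)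
    have h1 := norm_pow_sub_smul_kronAct_le (G ω) (z ω) hb hbN p
    have h2 := mul_nonneg hb (mul_nonneg (pow_nonneg (norm_nonneg (z ω)) p)
      (inner_kronAct_laplacian_nonneg (G ω) (z ω)))
    rw [Real.norm_of_nonneg (by positivity)]
    linarith
  refine ⟨hInt, ?_⟩
  -- The weighted form is linear in the entries of `L` with coefficients `Y n l` measurable with
  -- respect to the past, so independence factors each expectation and `L` may be replaced by its
  -- mean.
  set Y : Fin N → Fin N → Ω → ℝ := fun n l ω => ‖z ω‖ ^ p * inner ℝ (z ω n) (z ω l) with hY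
  have hYm : ∀ n l, Measurable[m] (Y n l) := fun n l =>
    (Continuous.measurable (f := fun y : Stack N d => ‖y‖ ^ p * inner ℝ (y n) (y l))
      (by fun_prop)).comp hz
  have hYi : ∀ n l, Integrable (Y n l) P := by
    intro n l
    refine hzi.mono' ((hYm n l).mono hm le_rfl).aestronglyMeasurable (ae_of_all _ fun ω => ?_)
    rw [hY, Real.norm_eq_abs, abs_mul, abs_of_nonneg (by positivity), pow_add, sq]
    gcongr
    refine (abs_real_inner_le_norm _ _).trans ?_
    gcongr <;> exact PiLp.norm_apply_le _ _
  have hLm := fun n l => measurable_entry hG n l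
  have hLYi : ∀ n l, Integrable (fun ω => laplacian (G ω) n l * Y n l ω) P := fun n l =>
    (hYi n l).bdd_mul (hLm n l).aestronglyMeasurable
      (ae_of_all _ fun ω => by
        rw [Real.norm_eq_abs]
        exact abs_laplacian_le (G ω) n l)
  have hprod : ∀ n l, ∫ ω, laplacian (G ω) n l * Y n l ω ∂P
      = (∫ ω, laplacian (G ω) n l ∂P) * ∫ ω, Y n l ω ∂P := by
    intro n l
    have hi : IndepFun (fun ω => laplacian (G ω) n l) (Y n l) P := by
      rw [IndepFun_iff_Indep]
      refine indep_of_indep_of_le_right (indep_of_indep_of_le_left hind ?_) (hYm n l).comap_le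
      exact (measurable_entry (comap_measurable fun ω => laplacian (G ω)) n l).comap_le
    exact hi.integral_fun_mul_eq_mul_integral (hLm n l).aestronglyMeasurable
      ((hYm n l).mono hm le_rfl).aestronglyMeasurable
  have hexp : ∀ (M : Matrix (Fin N) (Fin N) ℝ) ω, ‖z ω‖ ^ p * inner ℝ (z ω) (kronAct M (z ω))
      = ∑ n, ∑ l, M n l * Y n l ω := by
    intro M ω
    rw [inner_kronAct, Finset.mul_sum]
    refine Finset.sum_congr rfl fun n _ => ?_
    rw [Finset.mul_sum]
    refine Finset.sum_congr rfl fun l _ => ?_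
    simp only [hY]
    ring
  have hXi : Integrable (fun ω => ‖z ω‖ ^ p * inner ℝ (z ω) (kronAct (laplacian (G ω)) (z ω))) P := by
    simp_rw [hexp]
    exact integrable_finsetSum _ fun n _ => integrable_finsetSum _ fun l _ => hLYi n l
  set Mb : Matrix (Fin N) (Fin N) ℝ := Matrix.of fun i j => ∫ ω, laplacian (G ω) i j ∂P
  have hMi : Integrable (fun ω => ‖z ω‖ ^ p * inner ℝ (z ω) (kronAct Mb (z ω))) P := by
    simp_rw [hexp]
    exact integrable_finsetSum _ fun n _ => integrable_finsetSum _ fun l _ =>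
      (hYi n l).const_mul _
  have hsum : ∀ A : Fin N → Fin N → Ω → ℝ, (∀ n l, Integrable (A n l) P) →
      ∫ ω, ∑ n, ∑ l, A n l ω ∂P = ∑ n, ∑ l, ∫ ω, A n l ω ∂P := by
    intro A hA
    rw [integral_finsetSum _ fun n _ => integrable_finsetSum _ fun l _ => hA n l]
    exact Finset.sum_congr rfl fun n _ => integral_finsetSum _ fun l _ => hA n l
  have hEq : ∫ ω, ‖z ω‖ ^ p * inner ℝ (z ω) (kronAct (laplacian (G ω)) (z ω)) ∂P
      = ∫ ω, ‖z ω‖ ^ p * inner ℝ (z ω) (kronAct Mb (z ω)) ∂P := by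
    simp_rw [hexp]
    rw [hsum (fun n l ω => laplacian (G ω) n l * Y n l ω) hLYi,
      hsum (fun n l ω => Mb n l * Y n l ω) fun n l => (hYi n l).const_mul _]
    refine Finset.sum_congr rfl fun n _ => Finset.sum_congr rfl fun l _ => ?_
    rw [hprod, integral_const_mul]
    rfl
  have hlow : c * ∫ ω, ‖z ω‖ ^ (p + 2) ∂P
      ≤ ∫ ω, ‖z ω‖ ^ p * inner ℝ (z ω) (kronAct Mb (z ω)) ∂P := by
    rw [← integral_const_mul]
    refine integral_mono (hzi.const_mul _) hMi fun ω => ?_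
    have := mul_le_mul_of_nonneg_left (hcoer (z ω) (hz0 ω)) (pow_nonneg (norm_nonneg (z ω)) p)
    calc c * ‖z ω‖ ^ (p + 2) = ‖z ω‖ ^ p * (c * ‖z ω‖ ^ 2) := by ring
      _ ≤ _ := this
  calc ∫ ω, ‖z ω - b • kronAct (laplacian (G ω)) (z ω)‖ ^ (p + 2) ∂P
      ≤ ∫ ω, (‖z ω‖ ^ (p + 2)
        - b * (‖z ω‖ ^ p * inner ℝ (z ω) (kronAct (laplacian (G ω)) (z ω)))) ∂P :=
        integral_mono hInt (hzi.sub (hXi.const_mul _)) fun ω =>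
          norm_pow_sub_smul_kronAct_le (G ω) (z ω) hb hbN p
    _ = ∫ ω, ‖z ω‖ ^ (p + 2) ∂P
        - b * ∫ ω, ‖z ω‖ ^ p * inner ℝ (z ω) (kronAct Mb (z ω)) ∂P := by
        rw [integral_sub hzi (hXi.const_mul _), integral_const_mul, hEq]
    _ ≤ _ := by nlinarith [mul_le_mul_of_nonneg_left hlow hb]

/-- Convexity of the power at `a + b = (1 - θ) (a / (1 - θ)) + θ (b / θ)`. -/
theorem add_pow_le_convex {a b θ : ℝ} (ha : 0 ≤ a) (hb : 0 ≤ b) (h0 : 0 < θ) (h1 : θ < 1)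
    (q : ℕ) : (a + b) ^ q ≤ (1 - θ) * (a / (1 - θ)) ^ q + θ * (b / θ) ^ q := by
  have h2 : 0 < 1 - θ := by linarith
  have := (convexOn_pow q).2 (x := a / (1 - θ)) (Set.mem_Ici.2 (by positivity))
    (y := b / θ) (Set.mem_Ici.2 (by positivity)) h2.le h0.le (by ring)
  simp only [smul_eq_mul] at this
  rwa [mul_div_cancel₀ _ h2.ne', mul_div_cancel₀ _ h0.ne'] at this

/-- One step of the perturbed consensus dynamics. -/
theorem integral_norm_pow_perturbed_le {m mΩ : MeasurableSpace Ω} {P : Measure Ω} [IsProbabilityMeasure P]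
    (hm : m ≤ mΩ) {G : Ω → SimpleGraph (Fin N)}
    (hG : Measurable fun ω => laplacian (G ω))
    (hind : Indep (MeasurableSpace.comap (fun ω => laplacian (G ω)) inferInstance) m P)
    {c : ℝ} (hc : 0 < c) (hc1 : c ≤ 1) (hcoer : ∀ z : Stack N d, ∑ n, z n = 0 → c * ‖z‖ ^ 2
      ≤ inner ℝ z (kronAct (Matrix.of fun i j => ∫ ω, laplacian (G ω) i j ∂P) z))
    {z r : Ω → Stack N d} (hz : Measurable[m] z) (hz0 : ∀ ω, ∑ n, z ω n = 0) {p : ℕ}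
    (hzi : Integrable (fun ω => ‖z ω‖ ^ (p + 2)) P)
    (hr : Measurable r) (hri : Integrable (fun ω => ‖r ω‖ ^ (p + 2)) P)
    {b : ℝ} (hb : 0 < b) (hb1 : b ≤ 1) (hbN : 2 * N * b ≤ 1) :
    Integrable (fun ω => ‖z ω - b • kronAct (laplacian (G ω)) (z ω) + r ω‖ ^ (p + 2)) P ∧
    ∫ ω, ‖z ω - b • kronAct (laplacian (G ω)) (z ω) + r ω‖ ^ (p + 2) ∂P
      ≤ (1 - c / (p + 2) * b) * ∫ ω, ‖z ω‖ ^ (p + 2) ∂P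
        + (c / (p + 2) * b) * (∫ ω, ‖r ω‖ ^ (p + 2) ∂P) / (c / (p + 2) * b) ^ (p + 2) := by
  obtain ⟨hai, ha⟩ := integral_norm_pow_sub_smul_kronAct_le hm hG hind hcoer hz hz0 hzi hb.le hbN
  -- The weight `θ = c b / (p + 2)` is chosen so that Bernoulli gives `1 - c b ≤ (1 - θ) ^ (p + 2)`.
  -- The contraction then pays for the factor `(1 - θ) ^ (-(p + 2))` created by convexity, and a
  -- factor `1 - θ` survives.
  have hz' : Measurable z := hz.mono hm le_rfl
  have hLz := measurable_kronAct hG hz'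
  set a : Ω → Stack N d := fun ω => z ω - b • kronAct (laplacian (G ω)) (z ω) with hadef
  have ham : Measurable a := by fun_prop
  set θ := c / (p + 2) * b with hθ
  have hθ0 : 0 < θ := by positivity
  have hp : (0 : ℝ) ≤ p := p.cast_nonneg
  have hcp : c / (p + 2) ≤ 1 / 2 := by
    gcongr
    linarith
  have hθ1 : θ < 1 := by nlinarith
  have h1θ : 0 < 1 - θ := by linarith
  set S := ∫ ω, ‖z ω‖ ^ (p + 2) ∂P with hS
  have hS0 : 0 ≤ S := integral_nonneg fun ω => by positivity
  have hbound : ∀ ω, ‖a ω + r ω‖ ^ (p + 2)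
      ≤ (1 - θ) / (1 - θ) ^ (p + 2) * ‖a ω‖ ^ (p + 2) + θ / θ ^ (p + 2) * ‖r ω‖ ^ (p + 2) := by
    intro ω
    calc ‖a ω + r ω‖ ^ (p + 2) ≤ (‖a ω‖ + ‖r ω‖) ^ (p + 2) := by
          gcongr
          exact norm_add_le _ _
      _ ≤ _ := add_pow_le_convex (norm_nonneg _) (norm_nonneg _) hθ0 hθ1 _
      _ = _ := by
        rw [div_pow, div_pow]
        ring
  have hdom := (hai.const_mul ((1 - θ) / (1 - θ) ^ (p + 2))).add
    (hri.const_mul (θ / θ ^ (p + 2)))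
  have hInt : Integrable (fun ω => ‖a ω + r ω‖ ^ (p + 2)) P := by
    refine hdom.mono' (by fun_prop) (ae_of_all _ fun ω => ?_)
    rw [Real.norm_of_nonneg (by positivity)]
    exact hbound ω
  refine ⟨hInt, ?_⟩
  have hbern : 1 - c * b ≤ (1 - θ) ^ (p + 2) := by
    have := one_add_mul_le_pow (a := -θ) (by linarith) (p + 2)
    have e : ((p + 2 : ℕ) : ℝ) * -θ = -(c * b) := by
      rw [hθ]
      push_cast
      field_simp
    rw [e] at this
    simpa [sub_eq_add_neg] using this
  calc ∫ ω, ‖a ω + r ω‖ ^ (p + 2) ∂P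
      ≤ ∫ ω, ((1 - θ) / (1 - θ) ^ (p + 2) * ‖a ω‖ ^ (p + 2)
          + θ / θ ^ (p + 2) * ‖r ω‖ ^ (p + 2)) ∂P := integral_mono hInt hdom hbound
    _ = (1 - θ) / (1 - θ) ^ (p + 2) * ∫ ω, ‖a ω‖ ^ (p + 2) ∂P
          + θ / θ ^ (p + 2) * ∫ ω, ‖r ω‖ ^ (p + 2) ∂P := by
        rw [integral_add (hai.const_mul _) (hri.const_mul _), integral_const_mul,
          integral_const_mul]
    _ ≤ (1 - θ) / (1 - θ) ^ (p + 2) * ((1 - θ) ^ (p + 2) * S)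
          + θ / θ ^ (p + 2) * ∫ ω, ‖r ω‖ ^ (p + 2) ∂P := by
        gcongr
        exact ha.trans (mul_le_mul_of_nonneg_right hbern hS0)
    _ = _ := by
        rw [← mul_assoc, div_mul_cancel₀ _ (by positivity)]
        ring

/-! ### From recursions to rates, and from moments to almost sure decay -/

/-- Decay rate of sequences with a contraction factor `1 - c t ^ (-τ)` and forcing
`C t ^ (-τ - s)`. -/
theorem exists_le_rpow_of_recursion {a : ℕ → ℝ} {c C τ s : ℝ} (hc : 0 < c) (hτ0 : 0 < τ) (hτ : τ < 1)
    (hs : 0 ≤ s) (h : ∀ᶠ t : ℕ in atTop,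
      a (t + 1) ≤ (1 - c * (t : ℝ) ^ (-τ)) * a t + C * ((t : ℝ) ^ (-τ) * (t : ℝ) ^ (-s))) :
    ∃ M : ℝ, 0 ≤ M ∧ ∀ᶠ t : ℕ in atTop, a t ≤ M * (t : ℝ) ^ (-s) := by
  -- Passing from `t ^ (-s)` to `(t + 1) ^ (-s)` loses a relative amount `s / t`, which for `τ < 1`
  -- is eventually below half of the contraction `c t ^ (-τ)`.
  have hlim : Tendsto (fun t : ℕ => s * (t : ℝ) ^ (-(1 - τ))) atTop (𝓝 0) := by
    simpa using ((tendsto_rpow_neg_atTop (by linarith : 0 < 1 - τ)).comp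
      tendsto_natCast_atTop_atTop).const_mul s
  have hlim2 : Tendsto (fun t : ℕ => c * (t : ℝ) ^ (-τ)) atTop (𝓝 0) := by
    simpa using ((tendsto_rpow_neg_atTop hτ0).comp tendsto_natCast_atTop_atTop).const_mul c
  obtain ⟨T, hT⟩ := eventually_atTop.1 (h.and ((hlim.eventually_le_const (half_pos hc)).and
    ((hlim2.eventually_le_const one_pos).and (eventually_ge_atTop 1))))
  have hT1 : 1 ≤ T := (hT T le_rfl).2.2.2
  have hTpos : (0 : ℝ) < T := by exact_mod_cast hT1
  -- The entry `2 * C / c` lets the other half of the contraction absorb the forcing; the last entry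
  -- starts the induction.
  set M := max 0 (max (2 * C / c) (a T * (T : ℝ) ^ s)) with hM
  have hM0 : 0 ≤ M := le_max_left _ _
  have hM1 : 2 * C / c ≤ M := (le_max_left _ _).trans (le_max_right _ _)
  have hM2 : a T * (T : ℝ) ^ s ≤ M := (le_max_right _ _).trans (le_max_right _ _)
  refine ⟨M, hM0, eventually_atTop.2 ⟨T, fun t ht => ?_⟩⟩
  induction t, ht using Nat.le_induction with
  | base =>
    rw [Real.rpow_neg hTpos.le, ← div_eq_mul_inv, le_div_iff₀ (by positivity)]
    exact hM2
  | succ t ht ih =>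
    obtain ⟨h1, h2, h3, h4⟩ := hT t ht
    have htpos : (0 : ℝ) < t := by exact_mod_cast h4
    set x := (t : ℝ) ^ (-τ) with hx
    set y := (t : ℝ) ^ (-s) with hy
    have hxpos : 0 < x := Real.rpow_pos_of_pos htpos _
    have hypos : 0 < y := Real.rpow_pos_of_pos htpos _
    have e1 : (t : ℝ) ^ (-(1 - τ)) * x = 1 / t := by
      rw [hx, ← Real.rpow_add htpos, one_div, ← Real.rpow_neg_one]
      congr 1
      ring
    have hst : s / t ≤ c / 2 * x := by
      have := mul_le_mul_of_nonneg_right h2 hxpos.le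
      rw [mul_assoc, e1] at this
      calc s / t = s * (1 / t) := by ring
        _ ≤ _ := this
    -- Bernoulli
    have hbern : (1 - s / t) * y ≤ ((t + 1 : ℕ) : ℝ) ^ (-s) := by
      have hb : 1 - s / t ≤ (1 + 1 / (t : ℝ)) ^ (-s) := by
        have h5 : Real.log (1 + 1 / (t : ℝ)) ≤ 1 / t := by
          have := Real.log_le_sub_one_of_pos (x := 1 + 1 / (t : ℝ)) (by positivity)
          linarith
        rw [Real.rpow_def_of_pos (by positivity)]
        have h6 := Real.add_one_le_exp (Real.log (1 + 1 / (t : ℝ)) * -s)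
        have h7 := mul_le_mul_of_nonneg_right h5 hs
        have h8 : s / t = 1 / t * s := by ring
        linarith
      have e2 : ((t + 1 : ℕ) : ℝ) = (1 + 1 / (t : ℝ)) * t := by
        push_cast
        field_simp
      rw [e2, Real.mul_rpow (by positivity) htpos.le]
      gcongr
    have hCM : C ≤ M * (c / 2) := by
      rw [div_le_iff₀ hc] at hM1
      linarith
    calc a (t + 1) ≤ (1 - c * x) * a t + C * (x * y) := h1
      _ ≤ (1 - c * x) * (M * y) + M * (c / 2) * (x * y) := by
          gcongr
      _ = M * ((1 - c / 2 * x) * y) := by ring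
      _ ≤ M * ((1 - s / t) * y) := by gcongr
      _ ≤ _ := by gcongr

/-- Almost sure decay from decay of a moment. -/
theorem ae_tendsto_rpow_mul_norm [MeasurableSpace Ω] {P : Measure Ω} {E : Type*} [NormedAddCommGroup E]
    [MeasurableSpace E] [OpensMeasurableSpace E]
    {z : ℕ → Ω → E} (hz : ∀ t, Measurable (z t)) {q : ℕ} (hq : q ≠ 0)
    (hzi : ∀ᶠ t in atTop, Integrable (fun ω => ‖z t ω‖ ^ q) P) {M s τ : ℝ}
    (hM : ∀ᶠ t : ℕ in atTop, ∫ ω, ‖z t ω‖ ^ q ∂P ≤ M * (t : ℝ) ^ (-s)) (hs : 1 < s - q * τ) :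
    ∀ᵐ ω ∂P, Tendsto (fun t : ℕ => (t : ℝ) ^ τ * ‖z t ω‖) atTop (𝓝 0) := by
  obtain ⟨T, hT⟩ := eventually_atTop.1 (hzi.and (hM.and (eventually_ge_atTop 1)))
  set f : ℕ → Ω → ℝ := fun k ω => (((k + T : ℕ) : ℝ) ^ τ * ‖z (k + T) ω‖) ^ q with hf
  have hfm : ∀ k, Measurable (f k) := fun k => ((hz (k + T)).norm.const_mul _).pow_const q
  have hfnn : ∀ k ω, 0 ≤ f k ω := fun k ω => by positivity
  have hfi : ∀ k, Integrable (f k) P := fun k => by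
    simp only [hf, mul_pow]
    exact (hT (k + T) (by omega)).1.const_mul _
  have hbd : ∀ k, ∫ ω, f k ω ∂P ≤ M * ((k + T : ℕ) : ℝ) ^ (-(s - q * τ)) := by
    intro k
    obtain ⟨-, h2, h3⟩ := hT (k + T) (by omega)
    have hpos : (0 : ℝ) < ((k + T : ℕ) : ℝ) := by exact_mod_cast h3
    simp only [hf, mul_pow]
    rw [integral_const_mul]
    calc _ ≤ (((k + T : ℕ) : ℝ) ^ τ) ^ q * (M * ((k + T : ℕ) : ℝ) ^ (-s)) := by gcongr
      _ = M * (((k + T : ℕ) : ℝ) ^ (τ * q) * ((k + T : ℕ) : ℝ) ^ (-s)) := by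
        rw [← Real.rpow_mul_natCast hpos.le]
        ring
      _ = _ := by
        rw [← Real.rpow_add hpos]
        congr 2
        ring
  -- Summable expectations of nonnegative terms make the series converge almost surely, so its terms
  -- tend to zero.
  have hsum : Summable fun k => ∫ ω, f k ω ∂P := by
    refine Summable.of_nonneg_of_le (fun k => integral_nonneg (hfnn k)) hbd (Summable.mul_left _ ?_)
    exact (summable_nat_add_iff (f := fun t : ℕ => (t : ℝ) ^ (-(s - q * τ))) T).2
      (Real.summable_nat_rpow.2 (by linarith))
  have hae : ∀ᵐ ω ∂P, Summable fun k => ‖f k ω‖ := by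
    refine summable_norm_of_tsum_eLpNorm_ne_top (p := 1) le_rfl
      (fun k => (hfm k).aestronglyMeasurable) ?_
    have e : ∀ k, eLpNorm (f k) 1 P = ENNReal.ofReal (∫ ω, f k ω ∂P) := by
      intro k
      rw [eLpNorm_one_eq_lintegral_enorm, ofReal_integral_eq_lintegral_ofReal (hfi k)
        (ae_of_all _ (hfnn k))]
      refine lintegral_congr fun ω => ?_
      rw [Real.enorm_of_nonneg (hfnn k ω)]
    simp_rw [e]
    exact hsum.tsum_ofReal_lt_top.ne
  filter_upwards [hae] with ω hω
  have h1 := hω.of_norm.tendsto_atTop_zero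
  have h2 := h1.rpow_const (p := (q : ℝ)⁻¹) (Or.inr (by positivity))
  rw [Real.zero_rpow (by positivity)] at h2
  rw [← tendsto_add_atTop_iff_nat T]
  refine h2.congr fun k => ?_
  exact Real.pow_rpow_inv_natCast (by positivity) hq

/-! ### Moments of the noise and of perturbed consensus processes -/

/-- Moments of stacked standard Gaussian blocks. -/
theorem exists_integral_norm_pow_le [MeasurableSpace Ω] {P : Measure Ω} [IsProbabilityMeasure P]
    {w : ℕ → Ω → Stack N d} (hw : ∀ t, Measurable (w t))
    (hg : ∀ n t, P.map (fun ω => w t ω n) = stdGaussian (EuclideanSpace ℝ (Fin d))) (q : ℕ) :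
    ∃ W : ℝ, ∀ t, Integrable (fun ω => ‖w t ω‖ ^ (q + 1)) P
      ∧ ∫ ω, ‖w t ω‖ ^ (q + 1) ∂P ≤ W := by
  set I := ∫ y, ‖y‖ ^ (q + 1) ∂(stdGaussian (EuclideanSpace ℝ (Fin d))) with hI
  have hblk : ∀ n t, Measurable fun ω => w t ω n := fun n t =>
    (measurable_pi_apply n).comp ((WithLp.measurable_ofLp 2 _).comp (hw t))
  have hi0 : Integrable (fun y => ‖y‖ ^ (q + 1)) (stdGaussian (EuclideanSpace ℝ (Fin d))) :=
    (IsGaussian.memLp_id _ ((q + 1 : ℕ) : ENNReal) (by simp)).integrable_norm_pow (by omega)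
  have hi : ∀ n t, Integrable (fun ω => ‖w t ω n‖ ^ (q + 1)) P := fun n t => by
    have := hi0
    rw [← hg n t] at this
    exact this.comp_measurable (hblk n t)
  have hIe : ∀ n t, ∫ ω, ‖w t ω n‖ ^ (q + 1) ∂P = I := fun n t => by
    rw [hI, ← hg n t, integral_map (hblk n t).aemeasurable (by fun_prop)]
  have hbd : ∀ t ω, ‖w t ω‖ ^ (q + 1) ≤ (N : ℝ) ^ q * ∑ n, ‖w t ω n‖ ^ (q + 1) := by
    intro t ω
    have h1 : ‖w t ω‖ ≤ ∑ n, ‖w t ω n‖ := by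
      refine le_of_sq_le_sq ?_ (Finset.sum_nonneg fun n _ => norm_nonneg _)
      rw [PiLp.norm_sq_eq_of_L2]
      exact Finset.sum_sq_le_sq_sum_of_nonneg fun n _ => norm_nonneg _
    have h2 := pow_sum_le_card_mul_sum_pow (s := Finset.univ) (f := fun n => ‖w t ω n‖)
      (fun n _ => norm_nonneg _) q
    rw [Finset.card_univ, Fintype.card_fin] at h2
    exact (pow_le_pow_left₀ (norm_nonneg _) h1 _).trans h2
  have hdom : ∀ t, Integrable (fun ω => (N : ℝ) ^ q * ∑ n, ‖w t ω n‖ ^ (q + 1)) P := fun t =>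
    (integrable_finsetSum _ fun n _ => hi n t).const_mul _
  refine ⟨(N : ℝ) ^ q * ∑ _n : Fin N, I, fun t => ?_⟩
  have hint : Integrable (fun ω => ‖w t ω‖ ^ (q + 1)) P := by
    refine (hdom t).mono' (((hw t).norm.pow_const _).aestronglyMeasurable)
      (ae_of_all _ fun ω => ?_)
    rw [Real.norm_of_nonneg (by positivity)]
    exact hbd t ω
  refine ⟨hint, (integral_mono hint (hdom t) (hbd t)).trans_eq ?_⟩
  rw [integral_const_mul, integral_finsetSum _ fun n _ => hi n t]
  simp only [hIe]

/-- Moment decay of a perturbed consensus process whose perturbation `r t` has `q`-th moment of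
order `t ^ (-ρ q)`, up to a factor growing with the process. -/
theorem exists_integral_norm_pow_le_rpow [mΩ : MeasurableSpace Ω] {P : Measure Ω}
    [IsProbabilityMeasure P] {F : ℕ → MeasurableSpace Ω} (hF : ∀ t, F t ≤ mΩ)
    {G : ℕ → Ω → SimpleGraph (Fin N)} (hG : ∀ t, Measurable fun ω => laplacian (G t ω))
    (hind : ∀ t, Indep (MeasurableSpace.comap (fun ω => laplacian (G t ω)) inferInstance) (F t) P)
    {c : ℝ} (hc : 0 < c) (hc1 : c ≤ 1) (hcoer : ∀ t, ∀ z : Stack N d, ∑ n, z n = 0 → c * ‖z‖ ^ 2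
      ≤ inner ℝ z (kronAct (Matrix.of fun i j => ∫ ω, laplacian (G t ω) i j ∂P) z))
    {β : ℕ → ℝ} {cβ τβ : ℝ} (hcβ : 0 < cβ) (hτ0 : 0 < τβ) (hτ1 : τβ < 1) {t₀ : ℕ} (ht₀ : 1 ≤ t₀)
    (hβ : ∀ t ≥ t₀, β t = cβ * (t : ℝ) ^ (-τβ)) (hβ1 : ∀ t ≥ t₀, β t ≤ 1)
    (hβN : ∀ t ≥ t₀, 2 * N * β t ≤ 1)
    {z r : ℕ → Ω → Stack N d} (hz : ∀ t ≥ t₀, Measurable[F t] (z t))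
    (hz0 : ∀ t ω, ∑ n, z t ω n = 0) (hr : ∀ t, Measurable (r t))
    (hstep : ∀ t ≥ t₀, ∀ ω,
      z (t + 1) ω = z t ω - β t • kronAct (laplacian (G t ω)) (z t ω) + r t ω)
    {p : ℕ} (hzi : Integrable (fun ω => ‖z t₀ ω‖ ^ (p + 2)) P)
    (hri : ∀ t ≥ t₀, Integrable (fun ω => ‖z t ω‖ ^ (p + 2)) P →
      Integrable (fun ω => ‖r t ω‖ ^ (p + 2)) P)
    {R ρ : ℝ} (hR : 0 ≤ R) (hρ : τβ < ρ)
    (hrb : ∀ᶠ t : ℕ in atTop, Integrable (fun ω => ‖z t ω‖ ^ (p + 2)) P →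
      ∫ ω, ‖r t ω‖ ^ (p + 2) ∂P ≤ R * (t : ℝ) ^ (-(ρ * (p + 2))) * (1 + ∫ ω, ‖z t ω‖ ^ (p + 2) ∂P)) :
    (∀ t ≥ t₀, Integrable (fun ω => ‖z t ω‖ ^ (p + 2)) P) ∧
    ∃ M : ℝ, 0 ≤ M ∧ ∀ᶠ t : ℕ in atTop,
      ∫ ω, ‖z t ω‖ ^ (p + 2) ∂P ≤ M * (t : ℝ) ^ (-((p + 2) * (ρ - τβ))) := by
  have hβ0 : ∀ t ≥ t₀, 0 < β t := fun t ht => by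
    have : (0 : ℝ) < t := by exact_mod_cast ht₀.trans ht
    rw [hβ t ht]
    positivity
  have hone := fun t ht (hi : Integrable (fun ω => ‖z t ω‖ ^ (p + 2)) P) =>
    integral_norm_pow_perturbed_le (hF t) (hG t) (hind t) hc hc1 (hcoer t) (hz t ht) (hz0 t) hi
      (hr t) (hri t ht hi) (hβ0 t ht) (hβ1 t ht) (hβN t ht)
  have hint : ∀ t ≥ t₀, Integrable (fun ω => ‖z t ω‖ ^ (p + 2)) P := by
    intro t ht
    induction t, ht using Nat.le_induction with
    | base => exact hzi
    | succ t ht ih =>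
      simp_rw [hstep t ht]
      exact (hone t ht ih).1
  refine ⟨hint, ?_⟩
  set κ := c / (p + 2) * cβ with hκ
  have hκ0 : 0 < κ := by positivity
  set s := (p + 2 : ℝ) * (ρ - τβ) with hs
  have hs0 : 0 < s := mul_pos (by positivity) (by linarith)
  -- With `x = t ^ (-τβ)` and `y = t ^ (-s)`, the convexity weight is `κ x` and the moment of `r` is
  -- at most `R x ^ (p + 2) y (1 + A)`, so the forcing is `D x y (1 + A)`. As `D y` tends to 0, its
  -- part proportional to `A` is absorbed by half of the contraction.
  set D := κ / κ ^ (p + 2) * R with hD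
  have hD0 : 0 ≤ D := by positivity
  have hlim : Tendsto (fun t : ℕ => D * (t : ℝ) ^ (-s)) atTop (𝓝 0) := by
    simpa using ((tendsto_rpow_neg_atTop hs0).comp tendsto_natCast_atTop_atTop).const_mul D
  refine exists_le_rpow_of_recursion (c := κ / 2) (C := D) (τ := τβ) (by positivity) hτ0 hτ1 hs0.le ?_
  filter_upwards [hrb, hlim.eventually_le_const (half_pos hκ0), eventually_ge_atTop t₀]
    with t h1 h2 ht
  have htpos : (0 : ℝ) < t := by exact_mod_cast ht₀.trans ht
  have h1 := h1 (hint t ht)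
  have h3 := (hone t ht (hint t ht)).2
  simp_rw [← hstep t ht] at h3
  set A := ∫ ω, ‖z t ω‖ ^ (p + 2) ∂P with hA
  have hA0 : 0 ≤ A := integral_nonneg fun ω => by positivity
  set x := (t : ℝ) ^ (-τβ) with hx
  set y := (t : ℝ) ^ (-s) with hy
  have hx0 : 0 < x := by positivity
  have hθ : c / (p + 2) * β t = κ * x := by
    rw [hβ t ht, hκ]
    ring
  have hxy : (t : ℝ) ^ (-(ρ * (p + 2))) = x ^ (p + 2) * y := by
    rw [hx, hy, ← Real.rpow_mul_natCast htpos.le, ← Real.rpow_add htpos, hs]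
    congr 1
    push_cast
    ring
  rw [hθ] at h3
  rw [hxy] at h1
  calc _ ≤ (1 - κ * x) * A
        + κ * x * (R * (x ^ (p + 2) * y) * (1 + A)) / (κ * x) ^ (p + 2) := by
        refine h3.trans ?_
        gcongr
    _ = (1 - κ * x) * A + (D * y) * x * A + D * (x * y) := by
        rw [hD, mul_pow]
        field_simp
        ring
    _ ≤ (1 - κ * x) * A + (κ / 2) * x * A + D * (x * y) := by gcongr
    _ = _ := by ring

/-! ### Bounds on the gradient term -/

theorem continuous_disagreement : Continuous (disagreement : Stack N d → Stack N d) := by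
  change Continuous fun z : Stack N d =>
    (WithLp.toLp 2 (fun n => z n - (1 / (N : ℝ)) • ∑ l, z l) : Stack N d)
  fun_prop

theorem exists_norm_disagreement_le :
    ∃ C : ℝ, 0 ≤ C ∧ ∀ z : Stack N d, ‖disagreement z‖ ≤ C * ‖z‖ :=
  ⟨_, norm_nonneg _, ContinuousLinearMap.le_opNorm
    (⟨disagreement, continuous_disagreement⟩ : Stack N d →L[ℝ] Stack N d)⟩

theorem measurable_disagreement : Measurable (disagreement : Stack N d → Stack N d) :=
  continuous_disagreement.measurable

/-- The common vector `∇U` at the network average may be subtracted from all blocks without changing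
the disagreement. What is left in block `n` is a Lipschitz error in `z n - netAvg z` plus the
bounded dissimilarity. Hence the bound involves the disagreement only, never the possibly large
average. -/
theorem exists_norm_disagreement_stackGrad_le {U : Fin N → EuclideanSpace ℝ (Fin d) → ℝ}
    (hLip : LipschitzGradients U) (hSim : BoundedDissimilarity U) :
    ∃ B K : ℝ, 0 ≤ B ∧ 0 ≤ K ∧ ∀ z : Stack N d,
      ‖disagreement (stackGrad U z)‖ ≤ B + K * ‖disagreement z‖ := by
  obtain ⟨K, hK, hKL⟩ := hLip.lipschitz
  obtain ⟨C, hC, hCQ⟩ := exists_norm_disagreement_le (N := N) (d := d)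
  choose b hb using hSim
  have hb' : ∀ n y, ‖gradient (U n) y - gradient (avgObjective U) y‖ ≤ |b n| := fun n y =>
    (hb n ⟨y, rfl⟩).trans (le_abs_self _)
  refine ⟨C * ∑ n, |b n|, C * (N * K), by positivity, by positivity, fun z => ?_⟩
  set g := gradient (avgObjective U) (netAvg z) with hg
  have e : disagreement (stackGrad U z)
      = disagreement (stackGrad U z - WithLp.toLp 2 (fun _ : Fin N => g)) := by
    rw [map_sub, disagreement_const, sub_zero]
  have h1 : ∀ y : Stack N d, ‖y‖ ≤ ∑ n, ‖y n‖ := fun y => by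
    refine le_of_sq_le_sq ?_ (Finset.sum_nonneg fun n _ => norm_nonneg _)
    rw [PiLp.norm_sq_eq_of_L2]
    exact Finset.sum_sq_le_sq_sum_of_nonneg fun n _ => norm_nonneg _
  have h2 : ∀ n, ‖(stackGrad U z - WithLp.toLp 2 (fun _ : Fin N => g)) n‖
      ≤ K * ‖disagreement z‖ + |b n| := by
    intro n
    have e2 : (stackGrad U z - WithLp.toLp 2 (fun _ : Fin N => g)) n
        = (gradient (U n) (z n) - gradient (U n) (netAvg z))
          + (gradient (U n) (netAvg z) - g) := by
      rw [sub_add_sub_cancel]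
      rfl
    rw [e2]
    refine (norm_add_le _ _).trans (add_le_add ((hKL n _ _).trans ?_) (hb' n _))
    gcongr
    exact PiLp.norm_apply_le (disagreement z) n
  rw [e]
  calc _ ≤ C * ‖stackGrad U z - WithLp.toLp 2 (fun _ : Fin N => g)‖ := hCQ _
    _ ≤ C * ∑ n, (K * ‖disagreement z‖ + |b n|) := by
        gcongr
        exact (h1 _).trans (Finset.sum_le_sum fun n _ => h2 n)
    _ = _ := by
        rw [Finset.sum_add_distrib, Finset.sum_const, Finset.card_univ, Fintype.card_fin,
          nsmul_eq_mul]
        ring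

theorem measurable_stackGrad {U : Fin N → EuclideanSpace ℝ (Fin d) → ℝ}
    (hLip : LipschitzGradients U) : Measurable (stackGrad U) := by
  obtain ⟨K, hK, hKL⟩ := hLip.lipschitz
  have hc : ∀ n, Continuous (gradient (U n)) := fun n =>
    (LipschitzWith.of_dist_le_mul (K := K.toNNReal) fun y y' => by
      rw [dist_eq_norm, dist_eq_norm, Real.coe_toNNReal _ hK.le]
      exact hKL n y y').continuous
  refine (WithLp.measurable_toLp 2 _).comp (measurable_pi_lambda _ fun n => ?_)
  exact (hc n).measurable.comp ((measurable_pi_apply n).comp (WithLp.measurable_ofLp 2 _))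

/-! ### Measurability along the natural filtration -/

section Filtration

variable {x₀ : Ω → Stack N d} {G : ℕ → Ω → SimpleGraph (Fin N)} {ζ w : ℕ → Ω → Stack N d}

theorem natFiltration_mono : Monotone (natFiltration x₀ G ζ w) := by
  intro s t hst
  refine sup_le_sup_left (iSup_le fun i => ?_) _
  exact le_iSup_of_le (ι := Fin t) ⟨i, i.isLt.trans_le hst⟩ le_rfl

theorem natFiltration_le [mΩ : MeasurableSpace Ω] (hx₀ : Measurable x₀)
    (hG : ∀ t, Measurable fun ω => laplacian (G t ω)) (hζ : ∀ t, Measurable (ζ t))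
    (hw : ∀ t, Measurable (w t)) (t : ℕ) : natFiltration x₀ G ζ w t ≤ mΩ :=
  sup_le hx₀.comap_le (iSup_le fun s =>
    sup_le (sup_le (hG s).comap_le (hζ s).comap_le) (hw s).comap_le)

theorem measurable_init_natFiltration : Measurable[natFiltration x₀ G ζ w 0] x₀ :=
  measurable_iff_comap_le.2 le_sup_left

theorem le_natFiltration_succ (t : ℕ) :
    (MeasurableSpace.comap (fun ω => laplacian (G t ω)) inferInstance ⊔
        MeasurableSpace.comap (ζ t) inferInstance ⊔
        MeasurableSpace.comap (w t) inferInstance) ≤ natFiltration x₀ G ζ w (t + 1) :=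
  le_sup_of_le_right (le_iSup_of_le (ι := Fin (t + 1)) ⟨t, t.lt_succ_self⟩ le_rfl)

theorem measurable_laplacian_natFiltration (t : ℕ) :
    Measurable[natFiltration x₀ G ζ w (t + 1)] fun ω => laplacian (G t ω) :=
  measurable_iff_comap_le.2 ((le_sup_left.trans le_sup_left).trans (le_natFiltration_succ t))

theorem measurable_gradientNoise_natFiltration (t : ℕ) :
    Measurable[natFiltration x₀ G ζ w (t + 1)] (ζ t) :=
  measurable_iff_comap_le.2 ((le_sup_right.trans le_sup_left).trans (le_natFiltration_succ t))

theorem measurable_annealingNoise_natFiltration (t : ℕ) :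
    Measurable[natFiltration x₀ G ζ w (t + 1)] (w t) :=
  measurable_iff_comap_le.2 (le_sup_right.trans (le_natFiltration_succ t))

end Filtration

/-! ### Quantitative forms of the assumptions -/

theorem MeanConnectedLaplacians.exists_coercive [MeasurableSpace Ω] {P : Measure Ω}
    [IsProbabilityMeasure P] {x₀ : Ω → Stack N d} {G : ℕ → Ω → SimpleGraph (Fin N)}
    {ζ w : ℕ → Ω → Stack N d} (h : MeanConnectedLaplacians P x₀ G ζ w) :
    ∃ c : ℝ, 0 < c ∧ c ≤ 1 ∧ ∀ t, ∀ z : Stack N d, ∑ n, z n = 0 → c * ‖z‖ ^ 2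
      ≤ inner ℝ z (kronAct (Matrix.of fun i j => ∫ ω, laplacian (G t ω) i j ∂P) z) := by
  have hrow : ∀ n, ∑ l, meanLaplacian P G 0 n l = 0 := by
    intro n
    simp only [meanLaplacian, Matrix.of_apply]
    rw [← integral_finsetSum]
    · simp [sum_laplacian_row]
    · intro l _
      exact Integrable.of_bound (measurable_entry (h.measurable 0) n l).aestronglyMeasurable N
        (ae_of_all _ fun ω => abs_laplacian_le (G 0 ω) n l)
  obtain ⟨c, hc, hc1, hcz⟩ := exists_coercive_kronAct (d := d)
    (meanLaplacian_isHermitian P G 0) h.connected hrow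
  refine ⟨c, hc, hc1, fun t => ?_⟩
  have e : (Matrix.of fun i j => ∫ ω, laplacian (G t ω) i j ∂P) = meanLaplacian P G 0 := by
    ext i j
    exact ((h.identDistrib t).comp (u := fun A : Matrix (Fin N) (Fin N) ℝ => A i j)
      (measurable_entry measurable_id i j)).integral_eq
  rw [e]
  exact hcz

theorem GradientNoise.exists_integral_le [MeasurableSpace Ω] {P : Measure Ω}
    [IsProbabilityMeasure P] {x₀ : Ω → Stack N d} {G : ℕ → Ω → SimpleGraph (Fin N)}
    {ζ w : ℕ → Ω → Stack N d} (h : GradientNoise P x₀ G ζ w)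
    (hF : ∀ t, natFiltration x₀ G ζ w t ≤ ‹MeasurableSpace Ω›) :
    ∃ C : ℝ, 0 ≤ C ∧ ∀ t, ∫ ω, ‖ζ t ω‖ ^ 2 ∂P ≤ C := by
  obtain ⟨C, hC, hCt⟩ := h.condSecondMoment
  refine ⟨C, hC.le, fun t => ?_⟩
  rw [← integral_condExp (hF t)]
  refine (integral_mono_ae integrable_condExp (integrable_const C)
    ((hCt t).mono fun ω hω => hω.le)).trans_eq ?_
  simp

theorem Weights.exists_forall_ge {α β γ : ℕ → ℝ} {cα cβ cγ τβ : ℝ}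
    (h : Weights α β γ cα cβ cγ τβ) : ∃ t₀ : ℕ, 1 ≤ t₀ ∧ ∀ t ≥ t₀,
      |α t| = cα * (t : ℝ) ^ (-1 : ℝ) ∧ β t = cβ * (t : ℝ) ^ (-τβ) ∧ β t ≤ 1 ∧ 2 * N * β t ≤ 1 ∧
      |γ t| ≤ cγ * (t : ℝ) ^ (-(1 / 2) : ℝ) := by
  have hcα := h.cα_pos
  have hcγ := h.cγ_pos
  have hpow := (tendsto_rpow_neg_atTop h.τβ_mem.1).comp (tendsto_natCast_atTop_atTop (R := ℝ))
  have hlim1 : Tendsto (fun t : ℕ => cβ * (t : ℝ) ^ (-τβ)) atTop (𝓝 0) := by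
    simpa using hpow.const_mul cβ
  have hlim2 : Tendsto (fun t : ℕ => 2 * N * (cβ * (t : ℝ) ^ (-τβ))) atTop (𝓝 0) := by
    simpa using hlim1.const_mul (2 * N : ℝ)
  have hll := (Real.tendsto_log_atTop.comp Real.tendsto_log_atTop).comp
    (tendsto_natCast_atTop_atTop (R := ℝ))
  obtain ⟨T, hT⟩ := eventually_atTop.1 (h.α_eq.and (h.β_eq.and (h.γ_eq.and
    ((hlim1.eventually_le_const one_pos).and ((hlim2.eventually_le_const one_pos).and
      ((hll.eventually_ge_atTop 1).and (eventually_ge_atTop 1)))))))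
  refine ⟨T, (hT T le_rfl).2.2.2.2.2.2, fun t ht => ?_⟩
  obtain ⟨h1, h2, h3, h4, h5, h6, h7⟩ := hT t ht
  have htpos : (0 : ℝ) < t := by exact_mod_cast h7
  have e : β t = cβ * (t : ℝ) ^ (-τβ) := by
    rw [h2, Real.rpow_neg htpos.le, div_eq_mul_inv]
  refine ⟨?_, e, e ▸ h4, e ▸ h5, ?_⟩
  · rw [h1, abs_of_pos (by positivity), Real.rpow_neg_one, div_eq_mul_inv]
  -- The iterated logarithm is only used as a divisor at least 1; the rate `t ^ (-1/2)` suffices.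
  · have h8 : 1 ≤ Real.sqrt (Real.log (Real.log (t : ℝ))) := Real.one_le_sqrt.2 h6
    rw [h3, abs_of_nonneg (by positivity), Real.rpow_neg htpos.le, ← div_eq_mul_inv]
    gcongr
    exact le_mul_of_one_le_right (by positivity) h8

/-! ### Auxiliary consensus processes -/

/-- The perturbed consensus process `u (t + 1) = u t - β t (L t ⊗ I) u t + r t`, started at zero
at time `t₀`. -/
def consensusProcess (β : ℕ → ℝ) (G : ℕ → Ω → SimpleGraph (Fin N)) (r : ℕ → Ω → Stack N d)
    (t₀ : ℕ) : ℕ → Ω → Stack N d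
  | 0 => fun _ => 0
  | t + 1 => fun ω => if t < t₀ then 0 else
      consensusProcess β G r t₀ t ω
        - β t • kronAct (laplacian (G t ω)) (consensusProcess β G r t₀ t ω) + r t ω

theorem consensusProcess_start (β : ℕ → ℝ) (G : ℕ → Ω → SimpleGraph (Fin N))
    (r : ℕ → Ω → Stack N d) (t₀ : ℕ) (ω : Ω) : consensusProcess β G r t₀ t₀ ω = 0 := by
  cases t₀ <;> simp [consensusProcess]

theorem consensusProcess_succ (β : ℕ → ℝ) (G : ℕ → Ω → SimpleGraph (Fin N))
    (r : ℕ → Ω → Stack N d) {t₀ t : ℕ} (ht : t₀ ≤ t) (ω : Ω) :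
    consensusProcess β G r t₀ (t + 1) ω = consensusProcess β G r t₀ t ω
        - β t • kronAct (laplacian (G t ω)) (consensusProcess β G r t₀ t ω) + r t ω := by
  simp only [consensusProcess, if_neg (not_lt.2 ht)]

theorem measurable_consensusProcess {β : ℕ → ℝ} {G : ℕ → Ω → SimpleGraph (Fin N)}
    {r : ℕ → Ω → Stack N d} {t₀ : ℕ} {F : ℕ → MeasurableSpace Ω} (hF : Monotone F)
    (hG : ∀ t, Measurable[F (t + 1)] fun ω => laplacian (G t ω))
    (hr : ∀ t, Measurable[F (t + 1)] (r t)) (t : ℕ) :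
    Measurable[F t] (consensusProcess β G r t₀ t) := by
  induction t with
  | zero => exact measurable_const
  | succ t ih =>
    have hu := ih.mono (hF t.le_succ) le_rfl
    by_cases h : t < t₀
    · simp only [consensusProcess, if_pos h]
      exact measurable_const
    · simp only [consensusProcess, if_neg h]
      exact (hu.sub ((measurable_kronAct (hG t) hu).const_smul (β t))).add (hr t)

/-- The range of `disagreement` is invariant under Laplacians, and its elements have zero sum, which
is where coercivity applies. -/
theorem consensusProcess_mem_range {β : ℕ → ℝ} {G : ℕ → Ω → SimpleGraph (Fin N)}
    {r : ℕ → Ω → Stack N d} {t₀ : ℕ} (hr : ∀ t ω, r t ω ∈ LinearMap.range disagreement)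
    (t : ℕ) (ω : Ω) : consensusProcess β G r t₀ t ω ∈ LinearMap.range disagreement := by
  induction t with
  | zero => exact zero_mem _
  | succ t ih =>
    by_cases h : t < t₀
    · simp only [consensusProcess, if_pos h]
      exact zero_mem _
    · simp only [consensusProcess, if_neg h]
      refine add_mem (sub_mem ih (Submodule.smul_mem _ _ ?_)) (hr t ω)
      obtain ⟨y, hy⟩ := ih
      exact ⟨kronAct (laplacian (G t ω)) y, by rw [disagreement_kronAct_laplacian, hy]⟩

theorem sum_eq_zero_of_mem_range {z : Stack N d} (hz : z ∈ LinearMap.range disagreement) :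
    ∑ n, z n = 0 := by
  obtain ⟨y, rfl⟩ := hz
  exact sum_disagreement y

theorem measurable_of_update {F : ℕ → MeasurableSpace Ω} (hF : Monotone F)
    {U : Fin N → EuclideanSpace ℝ (Fin d) → ℝ} (hLip : LipschitzGradients U) {α β γ : ℕ → ℝ}
    {G : ℕ → Ω → SimpleGraph (Fin N)} {ζ w x : ℕ → Ω → Stack N d}
    (hG : ∀ t, Measurable[F (t + 1)] fun ω => laplacian (G t ω))
    (hζ : ∀ t, Measurable[F (t + 1)] (ζ t)) (hw : ∀ t, Measurable[F (t + 1)] (w t))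
    (hx₀ : Measurable[F 0] (x 0))
    (hstep : ∀ t ω, x (t + 1) ω = x t ω - β t • kronAct (laplacian (G t ω)) (x t ω)
      - α t • (stackGrad U (x t ω) + ζ t ω) + γ t • w t ω) (t : ℕ) : Measurable[F t] (x t) := by
  induction t with
  | zero => exact hx₀
  | succ t ih =>
    have hx := ih.mono (hF t.le_succ) le_rfl
    rw [funext (hstep t)]
    exact ((hx.sub ((measurable_kronAct (hG t) hx).const_smul (β t))).sub
      ((((measurable_stackGrad hLip).comp hx).add (hζ t)).const_smul (α t))).add
        ((hw t).const_smul (γ t))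

/-! ### Almost sure decay of the disagreement -/

/-- Second moment of a perturbation dominated by a sum of square integrable terms. -/
theorem integral_norm_sq_le_of_norm_le [MeasurableSpace Ω] {P : Measure Ω}
    [IsProbabilityMeasure P] {r f g h : Ω → Stack N d} (hr : Measurable r)
    (hf : Integrable (fun ω => ‖f ω‖ ^ 2) P) (hg : Integrable (fun ω => ‖g ω‖ ^ 2) P)
    (hh : Integrable (fun ω => ‖h ω‖ ^ 2) P) {a B K C : ℝ}
    (hb : ∀ ω, ‖r ω‖ ≤ a * (B + K * ‖f ω‖ + K * ‖g ω‖ + C * ‖h ω‖)) :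
    Integrable (fun ω => ‖r ω‖ ^ 2) P ∧
    ∫ ω, ‖r ω‖ ^ 2 ∂P ≤ a ^ 2 * (4 * (B ^ 2 + K ^ 2 * ∫ ω, ‖f ω‖ ^ 2 ∂P
      + K ^ 2 * ∫ ω, ‖g ω‖ ^ 2 ∂P + C ^ 2 * ∫ ω, ‖h ω‖ ^ 2 ∂P)) := by
  have i0 : Integrable (fun _ : Ω => B ^ 2) P := integrable_const _
  have i1 := hf.const_mul (K ^ 2)
  have i2 := hg.const_mul (K ^ 2)
  have i3 := hh.const_mul (C ^ 2)
  have i01 : Integrable (fun ω => B ^ 2 + K ^ 2 * ‖f ω‖ ^ 2) P := i0.add i1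
  have i012 : Integrable (fun ω => B ^ 2 + K ^ 2 * ‖f ω‖ ^ 2 + K ^ 2 * ‖g ω‖ ^ 2) P := i01.add i2
  have hdom : Integrable (fun ω => a ^ 2 * (4 * (B ^ 2 + K ^ 2 * ‖f ω‖ ^ 2 + K ^ 2 * ‖g ω‖ ^ 2
      + C ^ 2 * ‖h ω‖ ^ 2))) P := ((i012.add i3).const_mul _).const_mul _
  have hle : ∀ ω, ‖r ω‖ ^ 2 ≤ a ^ 2 * (4 * (B ^ 2 + K ^ 2 * ‖f ω‖ ^ 2 + K ^ 2 * ‖g ω‖ ^ 2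
      + C ^ 2 * ‖h ω‖ ^ 2)) := by
    intro ω
    refine (pow_le_pow_left₀ (norm_nonneg _) (hb ω) 2).trans ?_
    rw [mul_pow]
    gcongr
    nlinarith [sq_nonneg (B - K * ‖f ω‖), sq_nonneg (B - K * ‖g ω‖),
      sq_nonneg (B - C * ‖h ω‖), sq_nonneg (K * ‖f ω‖ - K * ‖g ω‖),
      sq_nonneg (K * ‖f ω‖ - C * ‖h ω‖), sq_nonneg (K * ‖g ω‖ - C * ‖h ω‖)]
  have hri : Integrable (fun ω => ‖r ω‖ ^ 2) P :=
    hdom.mono' (hr.norm.pow_const _).aestronglyMeasurable (ae_of_all _ fun ω => by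
      rw [Real.norm_of_nonneg (by positivity)]
      exact hle ω)
  refine ⟨hri, (integral_mono hri hdom hle).trans_eq ?_⟩
  rw [integral_const_mul, integral_const_mul, integral_add i012 i3, integral_add i01 i2,
    integral_add i0 i1, integral_const_mul, integral_const_mul, integral_const_mul]
  simp

set_option maxHeartbeats 1000000 in
-- Here the recursion holds at every `ω`, which makes the process adapted. The disagreement is
-- bounded by `u` and `v` up to a finite random factor, and the two decay for different reasons: `u`
-- through high moments, `v` through a faster rate.
theorem ae_tendsto_of_update [mΩ : MeasurableSpace Ω]
    {P : Measure Ω} [IsProbabilityMeasure P]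
    {U : Fin N → EuclideanSpace ℝ (Fin d) → ℝ}
    {α β γ : ℕ → ℝ} {cα cβ cγ τβ : ℝ}
    {G : ℕ → Ω → SimpleGraph (Fin N)}
    {ζ w x : ℕ → Ω → Stack N d}
    (hLip : LipschitzGradients U)
    (hSim : BoundedDissimilarity U)
    (hConn : MeanConnectedLaplacians P (x 0) G ζ w)
    (hNoise : GradientNoise P (x 0) G ζ w)
    (hGauss : GaussianNoise P (x 0) G ζ w)
    (hWeights : Weights α β γ cα cβ cγ τβ)
    (hx₀ : Measurable (x 0))
    (hstep : ∀ t ω, x (t + 1) ω = x t ω - β t • kronAct (laplacian (G t ω)) (x t ω)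
      - α t • (stackGrad U (x t ω) + ζ t ω) + γ t • w t ω)
    {τ : ℝ} (hτ : τ < 1 / 2 - τβ) :
    ∀ᵐ ω ∂P, Tendsto (fun t : ℕ => (t : ℝ) ^ τ * ‖disagreement (x t ω)‖) atTop (𝓝 0) := by
  set F := natFiltration (x 0) G ζ w with hFdef
  have hF : ∀ t, F t ≤ mΩ :=
    natFiltration_le hx₀ hConn.measurable hNoise.measurable hGauss.measurable
  have hFm : Monotone F := natFiltration_mono
  have hxF : ∀ t, Measurable[F t] (x t) := measurable_of_update hFm hLip
    measurable_laplacian_natFiltration measurable_gradientNoise_natFiltration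
    measurable_annealingNoise_natFiltration measurable_init_natFiltration hstep
  have hxm : ∀ t, Measurable (x t) := fun t => (hxF t).mono (hF t) le_rfl
  obtain ⟨c, hc, hc1, hcoer⟩ := hConn.exists_coercive
  obtain ⟨t₀, ht₀, hwt⟩ := hWeights.exists_forall_ge (N := N)
  obtain ⟨C, hC, hCQ⟩ := exists_norm_disagreement_le (N := N) (d := d)
  obtain ⟨B, K, hB, hK, hBK⟩ := exists_norm_disagreement_stackGrad_le hLip hSim
  obtain ⟨Cζ, hCζ, hζ2⟩ := hNoise.exists_integral_le hF
  have hτ0 := hWeights.τβ_mem.1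
  have hτ2 := hWeights.τβ_mem.2
  have hcα := hWeights.cα_pos
  have hcβ := hWeights.cβ_pos
  have hcγ := hWeights.cγ_pos
  have hQm := measurable_disagreement (N := N) (d := d)
  -- the part driven by the Gaussian noise
  set ru : ℕ → Ω → Stack N d := fun t ω => γ t • disagreement (w t ω) with hru
  set u := consensusProcess β G ru t₀ with hu
  have hruF : ∀ t, Measurable[F (t + 1)] (ru t) := fun t =>
    (hQm.comp (measurable_annealingNoise_natFiltration t)).const_smul (γ t)
  have hrum : ∀ t, Measurable (ru t) := fun t => (hruF t).mono (hF _) le_rfl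
  have huF : ∀ t, Measurable[F t] (u t) :=
    measurable_consensusProcess hFm measurable_laplacian_natFiltration hruF
  have hum : ∀ t, Measurable (u t) := fun t => (huF t).mono (hF t) le_rfl
  have hur : ∀ t ω, u t ω ∈ LinearMap.range disagreement :=
    consensusProcess_mem_range fun t ω => Submodule.smul_mem _ _ ⟨_, rfl⟩
  have hu0 : ∀ ω, u t₀ ω = 0 := consensusProcess_start β G ru t₀
  have humom : ∀ p : ℕ, (∀ t ≥ t₀, Integrable (fun ω => ‖u t ω‖ ^ (p + 2)) P) ∧
      ∃ M : ℝ, 0 ≤ M ∧ ∀ᶠ t : ℕ in atTop,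
        ∫ ω, ‖u t ω‖ ^ (p + 2) ∂P ≤ M * (t : ℝ) ^ (-((p + 2) * (1 / 2 - τβ))) := by
    intro p
    obtain ⟨W, hW⟩ := exists_integral_norm_pow_le hGauss.measurable hGauss.gaussian (p + 1)
    have hW0 : 0 ≤ W := (integral_nonneg fun ω => by positivity).trans (hW 0).2
    have hrub : ∀ t ω, ‖ru t ω‖ ^ (p + 2) ≤ (|γ t| * C) ^ (p + 2) * ‖w t ω‖ ^ (p + 2) := by
      intro t ω
      rw [← mul_pow, hru, norm_smul, Real.norm_eq_abs, mul_assoc]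
      gcongr
      exact hCQ _
    have hrui : ∀ t, Integrable (fun ω => ‖ru t ω‖ ^ (p + 2)) P := fun t =>
      ((hW t).1.const_mul ((|γ t| * C) ^ (p + 2))).mono'
        ((hrum t).norm.pow_const _).aestronglyMeasurable (ae_of_all _ fun ω => by
          rw [Real.norm_of_nonneg (by positivity)]
          exact hrub t ω)
    refine exists_integral_norm_pow_le_rpow hF hConn.measurable hConn.indep_past hc hc1 hcoer
      hcβ hτ0 (by linarith) ht₀ (fun t ht => (hwt t ht).2.1) (fun t ht => (hwt t ht).2.2.1)
      (fun t ht => (hwt t ht).2.2.2.1) (fun t _ => huF t)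
      (fun t ω => sum_eq_zero_of_mem_range (hur t ω)) hrum
      (fun t ht ω => consensusProcess_succ β G ru ht ω) ?_ (fun t _ _ => hrui t)
      (R := (cγ * C) ^ (p + 2) * W) (by positivity) hτ2 ?_
    · simp [hu0]
    · filter_upwards [eventually_ge_atTop t₀] with t ht _
      have htpos : (0 : ℝ) < t := by exact_mod_cast ht₀.trans ht
      have h1 := (hwt t ht).2.2.2.2
      have h2 : 0 ≤ ∫ ω, ‖u t ω‖ ^ (p + 2) ∂P := integral_nonneg fun ω => by positivity
      calc ∫ ω, ‖ru t ω‖ ^ (p + 2) ∂P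
          ≤ ∫ ω, (|γ t| * C) ^ (p + 2) * ‖w t ω‖ ^ (p + 2) ∂P :=
            integral_mono (hrui t) ((hW t).1.const_mul _) (hrub t)
        _ ≤ ((cγ * (t : ℝ) ^ (-(1 / 2) : ℝ)) * C) ^ (p + 2) * W := by
            rw [integral_const_mul]
            gcongr
            exact (hW t).2
        _ = (cγ * C) ^ (p + 2) * W * (t : ℝ) ^ (-(1 / 2 * (p + 2)) : ℝ) * 1 := by
            rw [mul_right_comm cγ, mul_pow, ← Real.rpow_mul_natCast htpos.le]
            push_cast
            ring_nf
        _ ≤ _ := by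
            gcongr
            linarith
  have hulim : ∀ᵐ ω ∂P, Tendsto (fun t : ℕ => (t : ℝ) ^ τ * ‖u t ω‖) atTop (𝓝 0) := by
    have hgap : 0 < 1 / 2 - τβ - τ := by linarith
    -- A moment order large enough that `(p + 2) (1/2 - τβ - τ) > 1`.
    obtain ⟨p, hp⟩ := exists_nat_gt (1 / (1 / 2 - τβ - τ))
    rw [div_lt_iff₀ hgap] at hp
    obtain ⟨hi, M, -, hM⟩ := humom p
    refine ae_tendsto_rpow_mul_norm hum (q := p + 2) (by omega)
      (eventually_atTop.2 ⟨t₀, hi⟩) hM ?_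
    push_cast
    nlinarith
  -- the remaining part, normalized by its size at time `t₀`
  set ϱ : Ω → ℝ := fun ω => (1 + ‖disagreement (x t₀ ω)‖)⁻¹ with hϱ
  have hϱF : Measurable[F t₀] ϱ :=
    Measurable.comp (g := fun z : Stack N d => (1 + ‖disagreement z‖)⁻¹)
      (hQm.norm.const_add 1).inv (hxF t₀)
  have hϱ0 : ∀ ω, 0 < ϱ ω := fun ω => by positivity
  have hϱ1 : ∀ ω, ϱ ω ≤ 1 := fun ω =>
    inv_le_one_of_one_le₀ (le_add_of_nonneg_right (norm_nonneg _))
  -- The Gaussian terms cancel in the difference. The factor `ϱ` is `F t₀`-measurable and constant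
  -- in time, so from `t₀` on `v` is adapted and satisfies the same linear recursion; as `u`
  -- vanishes at `t₀`, it starts with norm at most 1.
  set v : ℕ → Ω → Stack N d := fun t ω => ϱ ω • (disagreement (x t ω) - u t ω) with hv
  set rv : ℕ → Ω → Stack N d := fun t ω =>
    -(α t) • ϱ ω • disagreement (stackGrad U (x t ω) + ζ t ω) with hrv
  have hvF : ∀ t ≥ t₀, Measurable[F t] (v t) := fun t ht =>
    (hϱF.mono (hFm ht) le_rfl).smul ((hQm.comp (hxF t)).sub (huF t))
  have hvm : ∀ t, Measurable (v t) := fun t =>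
    (hϱF.mono (hF _) le_rfl).smul ((hQm.comp (hxm t)).sub (hum t))
  have hrvm : ∀ t, Measurable (rv t) := fun t =>
    ((hϱF.mono (hF _) le_rfl).smul (hQm.comp
      (((measurable_stackGrad hLip).comp (hxm t)).add (hNoise.measurable t)))).const_smul (-(α t))
  have hvr : ∀ t ω, v t ω ∈ LinearMap.range disagreement := fun t ω =>
    Submodule.smul_mem _ _ (sub_mem ⟨_, rfl⟩ (hur t ω))
  have hvstep : ∀ t ≥ t₀, ∀ ω,
      v (t + 1) ω = v t ω - β t • kronAct (laplacian (G t ω)) (v t ω) + rv t ω := by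
    intro t ht ω
    have h1 : u (t + 1) ω = u t ω - β t • kronAct (laplacian (G t ω)) (u t ω) + ru t ω :=
      consensusProcess_succ β G ru ht ω
    simp only [hv, hrv, h1, hstep t ω, map_add, map_sub, map_smul,
      disagreement_kronAct_laplacian, kronAct_smul, kronAct_sub, hru]
    module
  have hv0 : ∀ ω, ‖v t₀ ω‖ ≤ 1 := by
    intro ω
    simp only [hv, hu0, sub_zero]
    rw [norm_smul, Real.norm_of_nonneg (hϱ0 ω).le, hϱ, inv_mul_le_iff₀ (by positivity)]
    linarith
  have hvx : ∀ t ω, ϱ ω * ‖disagreement (x t ω)‖ ≤ ‖v t ω‖ + ‖u t ω‖ := by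
    intro t ω
    have h1 : ϱ ω • disagreement (x t ω) = v t ω + ϱ ω • u t ω := by
      simp only [hv]
      module
    have h2 := congrArg norm h1
    rw [norm_smul, Real.norm_of_nonneg (hϱ0 ω).le] at h2
    rw [h2]
    refine (norm_add_le _ _).trans (add_le_add le_rfl ?_)
    rw [norm_smul, Real.norm_of_nonneg (hϱ0 ω).le]
    exact mul_le_of_le_one_left (norm_nonneg _) (hϱ1 ω)
  -- The gradient term depends on the full disagreement, hence on `u` as well as on `v`; the second
  -- moment of `u` is already known to be bounded for large `t`.
  have hrvb : ∀ t ω, ‖rv t ω‖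
      ≤ |α t| * (B + K * ‖v t ω‖ + K * ‖u t ω‖ + C * ‖ζ t ω‖) := by
    intro t ω
    have h1 : ϱ ω * ‖disagreement (stackGrad U (x t ω) + ζ t ω)‖
        ≤ B + K * ‖v t ω‖ + K * ‖u t ω‖ + C * ‖ζ t ω‖ := by
      have h2 : ‖disagreement (stackGrad U (x t ω) + ζ t ω)‖
          ≤ B + K * ‖disagreement (x t ω)‖ + C * ‖ζ t ω‖ := by
        rw [map_add]
        exact (norm_add_le _ _).trans (add_le_add (hBK _) (hCQ _))
      calc _ ≤ ϱ ω * (B + K * ‖disagreement (x t ω)‖ + C * ‖ζ t ω‖) := by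
            gcongr
        _ = ϱ ω * B + K * (ϱ ω * ‖disagreement (x t ω)‖) + ϱ ω * (C * ‖ζ t ω‖) := by ring
        _ ≤ B + K * (‖v t ω‖ + ‖u t ω‖) + C * ‖ζ t ω‖ := by
            have h3 := mul_le_of_le_one_left hB (hϱ1 ω)
            have h4 := mul_le_mul_of_nonneg_left (hvx t ω) hK
            have h5 := mul_le_of_le_one_left (mul_nonneg hC (norm_nonneg (ζ t ω))) (hϱ1 ω)
            linarith
        _ = _ := by ring
    have h3 : ‖rv t ω‖ = |α t| * (ϱ ω * ‖disagreement (stackGrad U (x t ω) + ζ t ω)‖) := by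
      simp only [hrv]
      rw [norm_smul, norm_smul, norm_neg, Real.norm_eq_abs, Real.norm_of_nonneg (hϱ0 ω).le]
    rw [h3]
    gcongr
  obtain ⟨hui, Mu, hMu0, hMu⟩ := humom 0
  simp only [zero_add] at hui hMu
  have hζi : ∀ t, Integrable (fun ω => ‖ζ t ω‖ ^ 2) P := fun t =>
    (hNoise.memLp t).integrable_norm_pow two_ne_zero
  have hrv2 := fun t ht (hi : Integrable (fun ω => ‖v t ω‖ ^ 2) P) =>
    integral_norm_sq_le_of_norm_le (hrvm t) hi (hui t ht) (hζi t) (hrvb t)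
  have hrvE : ∀ᶠ t : ℕ in atTop, Integrable (fun ω => ‖v t ω‖ ^ 2) P →
      ∫ ω, ‖rv t ω‖ ^ 2 ∂P ≤ cα ^ 2 * (4 * (B ^ 2 + K ^ 2 + K ^ 2 * Mu + C ^ 2 * Cζ))
        * (t : ℝ) ^ (-(1 * ((0 : ℕ) + 2)) : ℝ) * (1 + ∫ ω, ‖v t ω‖ ^ 2 ∂P) := by
    filter_upwards [hMu, eventually_ge_atTop t₀] with t h1 ht hvi
    have ht1 : (1 : ℝ) ≤ t := by exact_mod_cast ht₀.trans ht
    have htpos : (0 : ℝ) < t := by linarith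
    have h2 : ∫ ω, ‖u t ω‖ ^ 2 ∂P ≤ Mu := h1.trans (mul_le_of_le_one_right hMu0
      (Real.rpow_le_one_of_one_le_of_nonpos ht1 (by
        push_cast
        linarith)))
    set A := ∫ ω, ‖v t ω‖ ^ 2 ∂P with hA
    have hA0 : 0 ≤ A := integral_nonneg fun ω => by positivity
    calc ∫ ω, ‖rv t ω‖ ^ 2 ∂P
        ≤ |α t| ^ 2 * (4 * (B ^ 2 + K ^ 2 * A
          + K ^ 2 * ∫ ω, ‖u t ω‖ ^ 2 ∂P + C ^ 2 * ∫ ω, ‖ζ t ω‖ ^ 2 ∂P)) :=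
          (hrv2 t ht hvi).2
      _ ≤ |α t| ^ 2 * (4 * (B ^ 2 + K ^ 2 * A + K ^ 2 * Mu + C ^ 2 * Cζ)) := by
          gcongr
          exact hζ2 t
      _ ≤ |α t| ^ 2 * (4 * ((B ^ 2 + K ^ 2 + K ^ 2 * Mu + C ^ 2 * Cζ) * (1 + A))) := by
          gcongr
          have : 0 ≤ B ^ 2 * A + K ^ 2 * Mu * A + C ^ 2 * Cζ * A + K ^ 2 := by positivity
          nlinarith
      _ = _ := by
          rw [(hwt t ht).1, mul_pow, ← Real.rpow_mul_natCast htpos.le]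
          norm_num
          ring
  obtain ⟨hvi, M, -, hM⟩ := exists_integral_norm_pow_le_rpow hF hConn.measurable
    hConn.indep_past hc hc1 hcoer hcβ hτ0 (by linarith) ht₀ (fun t ht => (hwt t ht).2.1)
    (fun t ht => (hwt t ht).2.2.1) (fun t ht => (hwt t ht).2.2.2.1) hvF
    (fun t ω => sum_eq_zero_of_mem_range (hvr t ω)) hrvm hvstep (p := 0) (ρ := 1)
    (R := cα ^ 2 * (4 * (B ^ 2 + K ^ 2 + K ^ 2 * Mu + C ^ 2 * Cζ))) (by
      refine (integrable_const (1 : ℝ)).mono' ((hvm t₀).norm.pow_const _).aestronglyMeasurable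
        (ae_of_all _ fun ω => ?_)
      rw [Real.norm_of_nonneg (by positivity)]
      exact pow_le_one₀ (norm_nonneg _) (hv0 ω)) (fun t ht hi => (hrv2 t ht hi).1) (by positivity) (by linarith) hrvE
  -- The second moment of `v` decays like `t ^ (-2 (1 - τβ))`, and `2 (1 - τβ) - 2 τ > 1` is exactly
  -- `τ < 1/2 - τβ`.
  have hvlim := ae_tendsto_rpow_mul_norm hvm (q := 2) (τ := τ) two_ne_zero
    (eventually_atTop.2 ⟨t₀, hvi⟩) hM (by
      push_cast
      linarith)
  filter_upwards [hulim, hvlim] with ω h1 h2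
  refine squeeze_zero (fun t => by positivity) (fun t => ?_)
    (by simpa using (h2.add h1).const_mul (ϱ ω)⁻¹)
  have h3 : ‖disagreement (x t ω)‖ ≤ (ϱ ω)⁻¹ * (‖v t ω‖ + ‖u t ω‖) :=
    (le_inv_mul_iff₀ (hϱ0 ω)).2 (hvx t ω)
  calc (t : ℝ) ^ τ * ‖disagreement (x t ω)‖
      ≤ (t : ℝ) ^ τ * ((ϱ ω)⁻¹ * (‖v t ω‖ + ‖u t ω‖)) := by gcongr
    _ = _ := by ring

/-! ### Passage from an almost sure recursion to an everywhere one -/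

/-- The process satisfying the update recursion for every `ω`. -/
def updateProcess (U : Fin N → EuclideanSpace ℝ (Fin d) → ℝ) (α β γ : ℕ → ℝ)
    (G : ℕ → Ω → SimpleGraph (Fin N)) (ζ w : ℕ → Ω → Stack N d) (x₀ : Ω → Stack N d) :
    ℕ → Ω → Stack N d
  | 0 => x₀
  | t + 1 => fun ω =>
    updateProcess U α β γ G ζ w x₀ t ω
      - β t • kronAct (laplacian (G t ω)) (updateProcess U α β γ G ζ w x₀ t ω)
      - α t • (stackGrad U (updateProcess U α β γ G ζ w x₀ t ω) + ζ t ω) + γ t • w t ω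

/-- The given process need be neither measurable after time 0 nor adapted, since its recursion may
fail on a null set; the modification is both, and has the same limits almost surely. -/
theorem IsUpdateProcess.ae_eq_updateProcess [MeasurableSpace Ω] {P : Measure Ω}
    {U : Fin N → EuclideanSpace ℝ (Fin d) → ℝ} {α β γ : ℕ → ℝ}
    {G : ℕ → Ω → SimpleGraph (Fin N)} {ζ w x : ℕ → Ω → Stack N d}
    (hx : IsUpdateProcess P U α β γ G ζ w x) :
    ∀ᵐ ω ∂P, ∀ t, x t ω = updateProcess U α β γ G ζ w (x 0) t ω := by
  filter_upwards [ae_all_iff.2 hx.step] with ω hω t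
  induction t with
  | zero => rfl
  | succ t ih => rw [hω t, ih, updateProcess]

end

end DistAnneal

theorem mainTheorem3 {N d : ℕ} {Ω : Type*} [MeasurableSpace Ω]
    (P : Measure Ω) [IsProbabilityMeasure P]
    (U : Fin N → EuclideanSpace ℝ (Fin d) → ℝ)
    (α β γ : ℕ → ℝ) (cα cβ cγ τβ : ℝ)
    (G : ℕ → Ω → SimpleGraph (Fin N))
    (ζ w x : ℕ → Ω → DistAnneal.Stack N d)
    (hLip : DistAnneal.LipschitzGradients U)
    (hSim : DistAnneal.BoundedDissimilarity U)
    (hConn : DistAnneal.MeanConnectedLaplacians P (x 0) G ζ w)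
    (hNoise : DistAnneal.GradientNoise P (x 0) G ζ w)
    (hGauss : DistAnneal.GaussianNoise P (x 0) G ζ w)
    (hWeights : DistAnneal.Weights α β γ cα cβ cγ τβ)
    (hx : DistAnneal.IsUpdateProcess P U α β γ G ζ w x) :
    ∀ τ ∈ Set.Ico (0 : ℝ) (1 / 2 - τβ), ∀ n : Fin N, ∀ᵐ ω ∂P,
      Tendsto (fun t : ℕ => ((t : ℝ) + 1) ^ τ * ‖x t ω n - DistAnneal.netAvg (x t ω)‖)
        atTop (𝓝 0) := by
  intro τ hτ n
  have h := DistAnneal.ae_tendsto_of_update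
    (x := DistAnneal.updateProcess U α β γ G ζ w (x 0)) hLip hSim hConn hNoise hGauss hWeights
    hx.measurable_init (fun _ _ => rfl) hτ.2
  filter_upwards [h, hx.ae_eq_updateProcess] with ω h1 h2
  -- For `t ≥ 1` and `τ ≥ 0`, `(t + 1) ^ τ ≤ 2 ^ τ * t ^ τ`, so the shift in the weight costs a
  -- constant.
  have h3 : Tendsto (fun t : ℕ => (2 : ℝ) ^ τ
      * ((t : ℝ) ^ τ * ‖DistAnneal.disagreement (x t ω)‖)) atTop (𝓝 0) := by
    simp only [h2]
    simpa using h1.const_mul ((2 : ℝ) ^ τ)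
  refine squeeze_zero' (Eventually.of_forall fun t => by positivity) ?_ h3
  filter_upwards [eventually_ge_atTop 1] with t ht
  have ht1 : (1 : ℝ) ≤ t := by exact_mod_cast ht
  rw [← mul_assoc, ← Real.mul_rpow (by norm_num) (by positivity)]
  refine mul_le_mul (Real.rpow_le_rpow (by positivity) (by linarith) hτ.1)
    (PiLp.norm_apply_le (DistAnneal.disagreement (x t ω)) n) (norm_nonneg _) (by positivity)
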